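/- Let $\mathbb V$ be a real $d$-dimensional vector space with Haar measure $dx$, and let $d\xi$ be the Haar measure on the dual space $\mathbb V^*$ normalized so that $\mathcal F f(\xi)=\int_{\mathbb V}e^{i\xi(x)}f(x)\,dx$ is unitary from $L^2(\mathbb V)$ to $L^2(\mathbb V^*)$. For $u\in\mathbb V$ put $D_u=i\,\partial/\partial u$, and for a basis $\mathbf v=\{v_1,\dots,v_d\}$ of $\mathbb V$ and a multi-index $\beta\in\mathbb N^d$ put $D_{\mathbf v}^\beta=D_{v_1}^{\beta_1}\cdots D_{v_d}^{\beta_d}$. For $\mathbf n\in\mathbb N_+^d$ put $|\beta:\mathbf n|=\sum_{k=1}^d\beta_k/n_k$. Let $\Lambda$ be a constant-coefficient partial differential operator on $\mathbb V$ with symbol $P:\mathbb V^*\to\mathbb C$, $P(\xi)=e^{i\xi(x)}\Lambda(e^{-i\xi(\cdot)})(x)$ (so that $D_{\mathbf v}^\beta$ has symbol $\xi(v_1)^{\beta_1}\cdots\xi(v_d)^{\beta_d}$), and let $R=\operatorname{Re}P$. The exponent set $\operatorname{Exp}(\Lambda)$ is the set of $E\in\operatorname{End}(\mathbb V)$ such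 that $\delta^E_{1/t}\circ\Lambda\circ\delta^E_t=t\Lambda$ for all $t>0$, where $\delta_t^Ef(x)=f(t^Ex)$ and $t^E=\exp((\log t)E)$. Assume that $\Lambda$ is positive-homogeneous: $R(\xi)\ge 0$ for all $\xi$, $R(\xi)=0$ only for $\xi=0$, and $\operatorname{Exp}(\Lambda)$ contains an endomorphism that is diagonalizable over $\mathbb R$. Let $\mu_\Lambda=\operatorname{tr}E$ for any $E\in\operatorname{Exp}(\Lambda)$ be the homogeneous order of $\Lambda$, let $$R^{\#}(x)=\sup_{\xi\in\mathbb V^*}\{\xi(x)-R(\xi)\}\quad(x\in\mathbb V)$$ be the Legendre–Fenchel transform of $R$, and let $$K_\Lambda^t(x)=\int_{\mathbb V^*}e^{-i\xi(x)}e^{-tP(\xi)}\,d\xi\qquad(t>0,\ x\in\mathbb V)$$ be the heat kernel of $\Lambda$. Then the integral defining $K_\Lambda^t$ converges absolutely for every $t>0$, $(t,x)\mapsto K_\Lambda^t(x)$ is smooth on $(0,\infty)\times\mathbb V$, and $R^{\#}$ is finite everywhere. There exist a basis $\mathbf v$ of $\mathbb V$ and $\mathbf m\in\mathbb N_+^d$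 such that $\Lambda=\sum_{|\beta:\mathbf m|=2}a_\beta D_{\mathbf v}^\beta$ for some $a_\beta\in\mathbb C$. For every such $\mathbf v$ and $\mathbf m$ there exist positive constants $C_0$ and $M$ and, for each multi-index $\beta$, a positive constant $C_\beta$ such that, for all $k\in\mathbb N$ and all multi-indices $\beta$, $$\left|\partial_t^kD_{\mathbf v}^\beta K_\Lambda^t(x-y)\right|\le\frac{C_\beta C_0^k\,k!}{t^{\mu_\Lambda+k+|\beta:2\mathbf m|}}\exp\left(-tMR^{\#}\left(\frac{x-y}{t}\right)\right)$$ for all $x,y\in\mathbb V$ and $t>0$. In particular, $$\left|K_\Lambda^t(x-y)\right|\le\frac{C_0}{t^{\mu_\Lambda}}\exp\left(-tMR^{\#}\left(\frac{x-y}{t}\right)\right)$$ for all $x,y\in\mathbb V$ and $t>0$. -/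

import Mathlib

open MeasureTheory
open scoped ContDiff SchwartzMap

noncomputable section

namespace PosHom

variable {V : Type*} [NormedAddCommGroup V] [NormedSpace ℝ V]

/-! Throughout, `V` is a finite-dimensional real vector space. The norm only provides the standard
topology and smooth structure, and `V →L[ℝ] ℝ` is the dual space `V*`. -/

/-- `D_u f = i ∂f/∂u`. -/
def dirD (u : V) (f : V → ℂ) : V → ℂ := fun x => Complex.I * lineDeriv ℝ f x u

/-- `D_v^β = (D_{v_1})^{β_1} (D_{v_2})^{β_2} ⋯ (D_{v_d})^{β_d}`. -/
def multiD {d : ℕ} (v : Fin d → V) (β : Fin d → ℕ) : (V → ℂ) → (V → ℂ) :=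
  (List.ofFn fun k : Fin d => (dirD (v k))^[β k]).foldr (fun A B => A ∘ B) id

/-- The operator `∑_β a_β D_v^β`, for a finitely supported family `a` of complex coefficients. -/
def diffOp {d : ℕ} (v : Fin d → V) (a : (Fin d → ℕ) →₀ ℂ) (f : V → ℂ) : V → ℂ :=
  fun x => a.sum fun β c => c * multiD v β f x

/-- `Λ` is a constant-coefficient partial differential operator on `V`. Only the values of `Λ` on
smooth functions are constrained, and only these are ever used. -/
def IsConstCoeffPDO (Λ : (V → ℂ) → (V → ℂ)) : Prop :=
  ∃ (d : ℕ) (u : Module.Basis (Fin d) ℝ V) (a : (Fin d → ℕ) →₀ ℂ),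
    ∀ f : V → ℂ, ContDiff ℝ ∞ f → Λ f = diffOp u a f

/-- The symbol `P(ξ) = e^{iξ(x)} Λ(e^{-iξ(·)})(x)`, which for a constant-coefficient operator does
not depend on `x`; it is evaluated at `x = 0`. The symbol of `D_v^β` is
`ξ ↦ ξ(v_1)^{β_1} ⋯ ξ(v_d)^{β_d}`. -/
def symbol (Λ : (V → ℂ) → (V → ℂ)) (ξ : V →L[ℝ] ℝ) : ℂ :=
  Λ (fun x => Complex.exp (-(Complex.I * (ξ x : ℂ)))) 0

/-- `t^E = exp((log t) E)`. -/
def tpow (t : ℝ) (E : V →L[ℝ] V) : V →L[ℝ] V := NormedSpace.exp (Real.log t • E)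

/-- `δ_t^E f (x) = f (t^E x)`. -/
def dilation (t : ℝ) (E : V →L[ℝ] V) (f : V → ℂ) : V → ℂ := fun x => f (tpow t E x)

/-- The exponent set of `Λ`: all `E ∈ End(V)` with `δ_{1/t}^E ∘ Λ ∘ δ_t^E = t Λ` for all `t > 0`. -/
def exponentSet (Λ : (V → ℂ) → (V → ℂ)) : Set (V →L[ℝ] V) :=
  {E | ∀ t : ℝ, 0 < t → ∀ f : V → ℂ, ContDiff ℝ ∞ f →
    dilation (1 / t) E (Λ (dilation t E f)) = fun x => (t : ℂ) * Λ f x}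

/-- `E` is diagonalizable (over `ℝ`): there is a basis of eigenvectors. -/
def IsDiagonalizable (E : V →L[ℝ] V) : Prop :=
  ∃ (d : ℕ) (w : Module.Basis (Fin d) ℝ V) (c : Fin d → ℝ), ∀ k, E (w k) = c k • w k

/-- Positive-homogeneous operators: constant-coefficient operators whose symbol is a
positive-definite polynomial and whose exponent set contains a diagonalizable endomorphism. -/
structure IsPositiveHomogeneous (Λ : (V → ℂ) → (V → ℂ)) : Prop where
  isConstCoeffPDO : IsConstCoeffPDO Λ
  re_symbol_nonneg : ∀ ξ : V →L[ℝ] ℝ, 0 ≤ (symbol Λ ξ).re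
  eq_zero_of_re_symbol : ∀ ξ : V →L[ℝ] ℝ, (symbol Λ ξ).re = 0 → ξ = 0
  exists_diagonalizable : ∃ E ∈ exponentSet Λ, IsDiagonalizable E

/-- `μ` is the homogeneous order of `Λ`: the trace of a member of the exponent set (all members
of it have the same trace when `Λ` is positive-homogeneous). -/
def IsHomogeneousOrder (Λ : (V → ℂ) → (V → ℂ)) (μ : ℝ) : Prop :=
  ∃ E ∈ exponentSet Λ, LinearMap.trace ℝ V (E : V →ₗ[ℝ] V) = μ

/-- `|β : n| = ∑_k β_k / n_k`. -/
def wt {d : ℕ} (β n : Fin d → ℕ) : ℝ := ∑ k, (β k : ℝ) / (n k : ℝ)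

/-- `Λ = ∑_{|β : m| = 2} a_β D_v^β` for some complex coefficients `a_β`, where `v` is a basis of
`V` and `m` is a `d`-tuple of positive integers. -/
def IsRepresentedBy {d : ℕ} (Λ : (V → ℂ) → (V → ℂ)) (v : Module.Basis (Fin d) ℝ V)
    (m : Fin d → ℕ) : Prop :=
  (∀ k, 0 < m k) ∧ ∃ a : (Fin d → ℕ) →₀ ℂ, (∀ β ∈ a.support, wt β m = 2) ∧
    ∀ f : V → ℂ, ContDiff ℝ ∞ f → Λ f = diffOp v a f

/-- The Legendre-Fenchel transform `R^#(x) = sup_ξ {ξ(x) - R(ξ)}`. -/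
def legendreFenchel (R : (V →L[ℝ] ℝ) → ℝ) (x : V) : ℝ := ⨆ ξ : V →L[ℝ] ℝ, (ξ x - R ξ)

/-- The Haar measure `ν` on `V*` is normalized with respect to the Haar measure `μ` on `V` so that
the Fourier transform `f ↦ ∫ e^{iξ(x)} f(x) dμ(x)` is unitary from `L²(V, μ)` to `L²(V*, ν)`. -/
def IsDualHaar [MeasurableSpace V] (μ : Measure V) (ν : Measure (V →L[ℝ] ℝ)) : Prop :=
  ∀ f : 𝓢(V, ℂ),
    ∫ ξ, ‖∫ x, Complex.exp (Complex.I * (ξ x : ℂ)) * f x ∂μ‖ ^ 2 ∂ν = ∫ x, ‖f x‖ ^ 2 ∂μ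

/-- The heat kernel `K_Λ^t(x) = ∫ e^{-iξ(x)} e^{-tP(ξ)} dξ`. -/
def heatKernel (ν : Measure (V →L[ℝ] ℝ)) (Λ : (V → ℂ) → (V → ℂ)) (t : ℝ) (x : V) : ℂ :=
  ∫ ξ : V →L[ℝ] ℝ,
    Complex.exp (-(Complex.I * (ξ x : ℂ))) * Complex.exp (-((t : ℂ) * symbol Λ ξ)) ∂ν

end PosHom

end

/-!
Write `P` for the symbol of `Λ` and `|z|_m = ∑_k |z_k|^{2 m_k}` for the anisotropic size attached to
the weights `m`.

*Weights.* In an eigenbasis of a diagonalizable exponent with eigenvalues `c_k`, homogeneity of `P`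
leaves only the monomials with `∑ c_k β_k = 1` (`sum_eigenvalue_mul_eq_one`). Restricting to the
coordinate axes, positivity of `Re P` forces `c_k = 1 / (2 m_k)` with `m_k` a positive integer
(`exists_eigenvalue_eq`), which is the required representation.

*Bounds on the symbol.* Given any representation, `P` is the restriction to `ℝ^d` of a polynomial
`p` on `ℂ^d` that is homogeneous of degree one for the dilations under which `|z|_m` is homogeneous
of degree one. A compactness argument gives
`|p(z)| ≤ A |z|_m` and `Re p(z) ≥ ε |z|_m - C |Im z|_m` (`exists_le_re_polyFun`). In particular
`Re P` dominates a positive multiple of `|ξ|_m`, so every integral converges, one may differentiate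
under the integral sign (`IsHeatSymbol.contDiffOn_heatInt`), and the Legendre-Fenchel transform
is finite.

*Estimates.* The derivative `∂_t^k D_v^β K^t(x)` is the integral of
`(-P(ξ))^k ξ^β e^{-iξ(x) - tP(ξ)}`, and the contour may be moved to `V* + iη`: the integral over
`V* + wη` is holomorphic in `w`, and constant for real `w` by translation invariance of Haar measure
(`integral_eq_of_forall_real`). On the shifted contour a part of the exponential decay absorbs
`|p|^k` at the price of `k!` and `|z^β|` at the price of a constant (`norm_integrand_le`), and there
remains `e^{η(x) + tC|η|_m} ∫ e^{-δt|ξ|_m} dξ`. The last integral is at most a multiple of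
`t^{-μ_Λ}`, by a linear change of variables along any exponent `E` and Jacobi's formula
`det t^E = t^{tr E}` (`integral_exp_neg_anisoSize_le`). Taking `η = -Mξ` with `M` small and using
`|Mξ|_m ≤ M^2 |ξ|_m`, which holds because the weights satisfy `2 m_k ≥ 2`, bounds the first factor
by `exp(-tM(ξ(x/t) - R(ξ)))`. Since `ξ` is arbitrary, `ξ(x/t) - R(ξ)` may be replaced by its
supremum.
-/

noncomputable section

namespace PosHom

/-! ### Constant-coefficient operators and their symbols -/

section Operators

variable {V : Type*} [NormedAddCommGroup V] [NormedSpace ℝ V]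

theorem dirD_eq_fderiv {f : V → ℂ} (hf : ContDiff ℝ ∞ f) (u : V) :
    dirD u f = fun x => Complex.I * fderiv ℝ f x u := by
  funext x
  simp only [dirD]
  rw [(hf.differentiable (by simp)).differentiableAt.lineDeriv_eq_fderiv]

theorem contDiff_dirD {f : V → ℂ} (hf : ContDiff ℝ ∞ f) (u : V) : ContDiff ℝ ∞ (dirD u f) := by
  rw [dirD_eq_fderiv hf]
  have h : ContDiff ℝ ∞ (fderiv ℝ f) := hf.fderiv_right (by simp)
  exact contDiff_const.mul (h.clm_apply contDiff_const)

theorem contDiff_dirD_iterate {f : V → ℂ} (hf : ContDiff ℝ ∞ f) (u : V) (n : ℕ) :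
    ContDiff ℝ ∞ ((dirD u)^[n] f) := by
  induction n with
  | zero => exact hf
  | succ n ih => rw [Function.iterate_succ_apply']; exact contDiff_dirD ih u

theorem dirD_comm {f : V → ℂ} (hf : ContDiff ℝ ∞ f) (u v : V) :
    dirD u (dirD v f) = dirD v (dirD u f) := by
  rw [dirD_eq_fderiv (contDiff_dirD hf v), dirD_eq_fderiv (contDiff_dirD hf u),
    dirD_eq_fderiv hf, dirD_eq_fderiv hf]
  have h : ContDiff ℝ ∞ (fderiv ℝ f) := hf.fderiv_right (by simp)
  have hd : Differentiable ℝ (fderiv ℝ f) := h.differentiable (by simp)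
  have key : ∀ (a b x : V), fderiv ℝ (fun y => Complex.I * fderiv ℝ f y a) x b =
      Complex.I * fderiv ℝ (fderiv ℝ f) x b a := by
    intro a b x
    have h1 : HasFDerivAt (fun y => fderiv ℝ f y a)
        ((fderiv ℝ (fderiv ℝ f) x).flip a) x := by
      simpa using (hd x).hasFDerivAt.clm_apply (hasFDerivAt_const a x)
    rw [(h1.const_mul Complex.I).fderiv]
    simp
  funext x
  rw [key, key]
  have := (hf.contDiffAt (x := x)).isSymmSndFDerivAt (by
    simp only [minSmoothness_of_isRCLikeNormedField]
    exact WithTop.coe_le_coe.2 (le_top (a := (2 : ℕ∞))))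
  rw [this.eq]

theorem dirD_iterate_comm {f : V → ℂ} (hf : ContDiff ℝ ∞ f) (u v : V) (n : ℕ) :
    dirD u ((dirD v)^[n] f) = (dirD v)^[n] (dirD u f) := by
  induction n with
  | zero => rfl
  | succ n ih =>
    rw [Function.iterate_succ_apply', Function.iterate_succ_apply',
      dirD_comm (contDiff_dirD_iterate hf v n), ih]

theorem multiD_zero (v : Fin 0 → V) (β : Fin 0 → ℕ) (f : V → ℂ) : multiD v β f = f := by
  simp [multiD]

theorem multiD_succ {d : ℕ} (v : Fin (d + 1) → V) (β : Fin (d + 1) → ℕ) (f : V → ℂ) :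
    multiD v β f = (dirD (v 0))^[β 0] (multiD (fun k => v k.succ) (fun k => β k.succ) f) := by
  simp [multiD, List.ofFn_succ]

theorem contDiff_multiD {d : ℕ} (v : Fin d → V) (β : Fin d → ℕ) {f : V → ℂ}
    (hf : ContDiff ℝ ∞ f) : ContDiff ℝ ∞ (multiD v β f) := by
  induction d with
  | zero => rwa [multiD_zero]
  | succ d ih => rw [multiD_succ]; exact contDiff_dirD_iterate (ih _ _) _ _

theorem dirD_multiD {d : ℕ} (v : Fin d → V) (β : Fin d → ℕ) (j : Fin d) {f : V → ℂ}
    (hf : ContDiff ℝ ∞ f) : dirD (v j) (multiD v β f) = multiD v (β + Pi.single j 1) f := by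
  induction d with
  | zero => exact j.elim0
  | succ d ih =>
    rw [multiD_succ, multiD_succ]
    refine Fin.cases ?_ (fun i => ?_) j
    · rw [← Function.iterate_succ_apply' (dirD (v 0))]
      simp
    · rw [dirD_iterate_comm (contDiff_multiD _ _ hf), ih (fun k => v k.succ) _ i]
      have h0 : (β + Pi.single i.succ 1 : Fin (d + 1) → ℕ) 0 = β 0 := by simp
      have h1 : (fun k : Fin d => β k.succ) + Pi.single i 1 =
          fun k : Fin d => (β + Pi.single i.succ 1 : Fin (d + 1) → ℕ) k.succ := by
        funext k
        simp [Pi.single_apply]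
      rw [h0, h1]

theorem diffOp_add {d : ℕ} (v : Fin d → V) (a b : (Fin d → ℕ) →₀ ℂ) (f : V → ℂ) :
    diffOp v (a + b) f = diffOp v a f + diffOp v b f := by
  funext x
  simp only [diffOp, Pi.add_apply]
  rw [Finsupp.sum_add_index'] <;> simp [add_mul]

theorem diffOp_single {d : ℕ} (v : Fin d → V) (β : Fin d → ℕ) (c : ℂ) (f : V → ℂ) :
    diffOp v (Finsupp.single β c) f = fun x => c * multiD v β f x := by
  funext x
  simp [diffOp]

theorem diffOp_smul {d : ℕ} (v : Fin d → V) (c : ℂ) (a : (Fin d → ℕ) →₀ ℂ) (f : V → ℂ) :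
    diffOp v (c • a) f = fun x => c * diffOp v a f x := by
  funext x
  simp only [diffOp]
  rw [Finsupp.sum_smul_index' (by simp), Finsupp.mul_sum]
  simp [mul_assoc]

theorem diffOp_zero {d : ℕ} (v : Fin d → V) (f : V → ℂ) : diffOp v 0 f = 0 := by
  funext x
  simp [diffOp]

theorem contDiff_diffOp {d : ℕ} (v : Fin d → V) (a : (Fin d → ℕ) →₀ ℂ) {f : V → ℂ}
    (hf : ContDiff ℝ ∞ f) : ContDiff ℝ ∞ (diffOp v a f) := by
  unfold diffOp Finsupp.sum
  refine ContDiff.sum fun β _ => contDiff_const.mul (contDiff_multiD v β hf)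

theorem dirD_add {f g : V → ℂ} (hf : ContDiff ℝ ∞ f) (hg : ContDiff ℝ ∞ g) (u : V) :
    dirD u (f + g) = dirD u f + dirD u g := by
  rw [show f + g = fun x => f x + g x from rfl, dirD_eq_fderiv (hf.add hg), dirD_eq_fderiv hf,
    dirD_eq_fderiv hg]
  funext x
  rw [fderiv_fun_add (hf.differentiable (by simp)).differentiableAt
    (hg.differentiable (by simp)).differentiableAt]
  simp [mul_add]

theorem dirD_const_mul {f : V → ℂ} (hf : ContDiff ℝ ∞ f) (c : ℂ) (u : V) :
    dirD u (fun x => c * f x) = fun x => c * dirD u f x := by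
  rw [dirD_eq_fderiv (contDiff_const.mul hf), dirD_eq_fderiv hf]
  funext x
  rw [fderiv_const_mul (hf.differentiable (by simp)).differentiableAt]
  simp only [_root_.smul_apply, smul_eq_mul]
  ring

theorem dirD_sum {ι : Type*} (s : Finset ι) (c : ι → ℝ) (u : ι → V) {f : V → ℂ}
    (hf : ContDiff ℝ ∞ f) :
    dirD (∑ i ∈ s, c i • u i) f = fun x => ∑ i ∈ s, (c i : ℂ) * dirD (u i) f x := by
  funext x
  simp only [dirD_eq_fderiv hf, map_sum, map_smul, Complex.real_smul, Finset.mul_sum]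
  exact Finset.sum_congr rfl fun i _ => by ring

/-- The operator `T` agrees on smooth functions with a polynomial in the derivatives `D_{v_k}`. -/
def IsDiffOpIn {d : ℕ} (v : Fin d → V) (T : (V → ℂ) → (V → ℂ)) : Prop :=
  ∃ a : (Fin d → ℕ) →₀ ℂ, ∀ f : V → ℂ, ContDiff ℝ ∞ f → T f = diffOp v a f

namespace IsDiffOpIn

variable {d : ℕ} {v : Fin d → V} {S T : (V → ℂ) → (V → ℂ)}

theorem add (hS : IsDiffOpIn v S) (hT : IsDiffOpIn v T) :
    IsDiffOpIn v (fun f => S f + T f) := by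
  obtain ⟨a, ha⟩ := hS
  obtain ⟨b, hb⟩ := hT
  exact ⟨a + b, fun f hf => by beta_reduce; rw [diffOp_add, ha f hf, hb f hf]⟩

theorem const_mul (c : ℂ) (hT : IsDiffOpIn v T) : IsDiffOpIn v (fun f x => c * T f x) := by
  obtain ⟨b, hb⟩ := hT
  exact ⟨c • b, fun f hf => by beta_reduce; rw [diffOp_smul, hb f hf]⟩

theorem zero : IsDiffOpIn v (fun _ => 0) := ⟨0, fun f _ => (diffOp_zero v f).symm⟩

theorem id : IsDiffOpIn v (fun f => f) := by
  refine ⟨Finsupp.single 0 1, fun f hf => ?_⟩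
  rw [diffOp_single]
  have : multiD v 0 f = f := by
    induction d with
    | zero => exact multiD_zero _ _ _
    | succ d ih =>
      rw [multiD_succ]
      exact ih (v := fun k => v k.succ)
  simp [this]

theorem sum {ι : Type*} (s : Finset ι) {T : ι → (V → ℂ) → (V → ℂ)}
    (hT : ∀ i ∈ s, IsDiffOpIn v (T i)) :
    IsDiffOpIn v (fun f x => ∑ i ∈ s, T i f x) := by
  classical
  induction s using Finset.induction_on with
  | empty => exact zero
  | insert i s his ih =>
    have := (hT i (by simp)).add (ih fun j hj => hT j (by simp [hj]))
    refine (congrArg (IsDiffOpIn v) ?_).mp this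
    funext f x
    simp [Finset.sum_insert his]

theorem congr (hT : IsDiffOpIn v T) (h : ∀ f : V → ℂ, ContDiff ℝ ∞ f → S f = T f) :
    IsDiffOpIn v S := by
  obtain ⟨a, ha⟩ := hT
  exact ⟨a, fun f hf => by rw [h f hf, ha f hf]⟩

theorem dirD_diffOp (j : Fin d) (a : (Fin d → ℕ) →₀ ℂ) :
    IsDiffOpIn v (fun f => dirD (v j) (diffOp v a f)) := by
  induction a using Finsupp.induction_linear with
  | zero =>
    refine zero.congr fun f _ => ?_
    funext x
    simp [diffOp_zero, dirD, lineDeriv]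
  | add a b iha ihb =>
    refine (iha.add ihb).congr fun f hf => ?_
    rw [diffOp_add, dirD_add (contDiff_diffOp v a hf) (contDiff_diffOp v b hf)]
  | single β c =>
    refine ⟨Finsupp.single (β + Pi.single j 1) c, fun f hf => ?_⟩
    beta_reduce
    rw [diffOp_single, diffOp_single, dirD_const_mul (contDiff_multiD v β hf),
      dirD_multiD v β j hf]

theorem dirD_member (j : Fin d) (hT : IsDiffOpIn v T) :
    IsDiffOpIn v (fun f => dirD (v j) (T f)) := by
  obtain ⟨a, ha⟩ := hT
  exact (dirD_diffOp j a).congr fun f hf => by rw [ha f hf]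

theorem contDiff (hT : IsDiffOpIn v T) {f : V → ℂ} (hf : ContDiff ℝ ∞ f) :
    ContDiff ℝ ∞ (T f) := by
  obtain ⟨a, ha⟩ := hT
  rw [ha f hf]
  exact contDiff_diffOp v a hf

theorem dirD (w : Module.Basis (Fin d) ℝ V) (u : V) (hT : IsDiffOpIn w T) :
    IsDiffOpIn w (fun f => dirD u (T f)) := by
  refine (sum Finset.univ fun j _ =>
    (hT.dirD_member j).const_mul ((w.repr u j : ℝ) : ℂ)).congr fun f hf => ?_
  conv_lhs => rw [← w.sum_repr u]
  rw [dirD_sum _ _ _ (hT.contDiff hf)]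

theorem dirD_iterate (w : Module.Basis (Fin d) ℝ V) (u : V) (n : ℕ) (hT : IsDiffOpIn w T) :
    IsDiffOpIn w (fun f => (PosHom.dirD u)^[n] (T f)) := by
  induction n with
  | zero => exact hT
  | succ n ih =>
    simp only [Function.iterate_succ_apply']
    exact ih.dirD w u

theorem multiD (w : Module.Basis (Fin d) ℝ V) {e : ℕ} (u : Fin e → V) (β : Fin e → ℕ) :
    IsDiffOpIn w (multiD u β) := by
  induction e with
  | zero => exact id.congr fun f _ => multiD_zero _ _ _
  | succ e ih =>
    exact ((ih (fun k => u k.succ) fun k => β k.succ).dirD_iterate w (u 0) (β 0)).congr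
      fun f _ => multiD_succ _ _ _

/-- A polynomial in the derivatives along any family of vectors is a polynomial in the
derivatives along a given basis. -/
theorem diffOp (w : Module.Basis (Fin d) ℝ V) {e : ℕ} (u : Fin e → V) (a : (Fin e → ℕ) →₀ ℂ) :
    IsDiffOpIn w (diffOp u a) :=
  (sum a.support fun β _ => (multiD w u β).const_mul (a β)).congr fun _ _ => rfl

end IsDiffOpIn

theorem IsConstCoeffPDO.isDiffOpIn {Λ : (V → ℂ) → (V → ℂ)} (hΛ : IsConstCoeffPDO Λ) {d : ℕ}
    (w : Module.Basis (Fin d) ℝ V) : IsDiffOpIn w Λ := by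
  obtain ⟨e, u, a, ha⟩ := hΛ
  exact (IsDiffOpIn.diffOp w u a).congr ha

/-- The polynomial function `z ↦ ∑_β a_β z^β` on `ℂ^d`. -/
def polyFun {d : ℕ} (a : (Fin d → ℕ) →₀ ℂ) (z : Fin d → ℂ) : ℂ :=
  a.sum fun β c => c * ∏ k, z k ^ β k

/-- The vector `(ξ(v_1), …, ξ(v_d))`, viewed in `ℂ^d`. -/
def coords {d : ℕ} (v : Fin d → V) (ξ : V →L[ℝ] ℝ) : Fin d → ℂ := fun k => (ξ (v k) : ℂ)

/-- The function `e^{-iξ(·)}`. -/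
def planeWave (ξ : V →L[ℝ] ℝ) (x : V) : ℂ := Complex.exp (-(Complex.I * (ξ x : ℂ)))

theorem contDiff_planeWave (ξ : V →L[ℝ] ℝ) : ContDiff ℝ ∞ (planeWave ξ) := by
  unfold planeWave
  have h : ContDiff ℝ ∞ fun x => (ξ x : ℂ) := Complex.ofRealCLM.contDiff.comp ξ.contDiff
  exact (contDiff_const.mul h).neg.cexp

theorem dirD_planeWave (ξ : V →L[ℝ] ℝ) (u : V) :
    dirD u (planeWave ξ) = fun x => (ξ u : ℂ) * planeWave ξ x := by
  rw [dirD_eq_fderiv (contDiff_planeWave ξ)]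
  funext x
  have h : HasFDerivAt (fun x => (ξ x : ℂ)) (Complex.ofRealCLM.comp ξ) x :=
    (Complex.ofRealCLM.comp ξ).hasFDerivAt
  have h2 := (h.const_mul Complex.I).fun_neg.cexp
  unfold planeWave
  rw [h2.fderiv]
  simp only [_root_.smul_apply, _root_.neg_apply, ContinuousLinearMap.comp_apply,
    Complex.ofRealCLM_apply, smul_eq_mul]
  linear_combination (-(ξ u : ℂ) * Complex.exp (-(Complex.I * (ξ x : ℂ)))) * Complex.I_mul_I

theorem multiD_planeWave {d : ℕ} (v : Fin d → V) (β : Fin d → ℕ) (ξ : V →L[ℝ] ℝ) :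
    multiD v β (planeWave ξ) = fun x => (∏ k, coords v ξ k ^ β k) * planeWave ξ x := by
  induction d with
  | zero => simp [multiD_zero]
  | succ d ih =>
    rw [multiD_succ, ih, Fin.prod_univ_succ]
    have h : ∀ (n : ℕ) (c : ℂ), (dirD (v 0))^[n] (fun x => c * planeWave ξ x) =
        fun x => (ξ (v 0) : ℂ) ^ n * c * planeWave ξ x := by
      intro n c
      induction n with
      | zero => simp
      | succ n ihn =>
        rw [Function.iterate_succ_apply', ihn, dirD_const_mul (contDiff_planeWave ξ),
          dirD_planeWave]
        funext x
        ring
    rw [h]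
    rfl

theorem diffOp_planeWave {d : ℕ} (v : Fin d → V) (a : (Fin d → ℕ) →₀ ℂ) (ξ : V →L[ℝ] ℝ) (x : V) :
    diffOp v a (planeWave ξ) x = polyFun a (coords v ξ) * planeWave ξ x := by
  simp only [diffOp, polyFun, multiD_planeWave, Finsupp.sum, Finset.sum_mul, mul_assoc]

theorem symbol_eq_polyFun {Λ : (V → ℂ) → (V → ℂ)} {d : ℕ} {v : Fin d → V}
    {a : (Fin d → ℕ) →₀ ℂ} (h : ∀ f : V → ℂ, ContDiff ℝ ∞ f → Λ f = diffOp v a f)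
    (ξ : V →L[ℝ] ℝ) : symbol Λ ξ = polyFun a (coords v ξ) := by
  have : symbol Λ ξ = Λ (planeWave ξ) 0 := rfl
  rw [this, h _ (contDiff_planeWave ξ), diffOp_planeWave]
  simp [planeWave]

/-- Homogeneity of the symbol: `P(ξ ∘ t^E) = t P(ξ)` for `E` in the exponent set. -/
theorem symbol_comp_tpow {Λ : (V → ℂ) → (V → ℂ)} {E : V →L[ℝ] V} (hE : E ∈ exponentSet Λ) {t : ℝ}
    (ht : 0 < t) (ξ : V →L[ℝ] ℝ) : symbol Λ (ξ.comp (tpow t E)) = (t : ℂ) * symbol Λ ξ := by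
  have h := congrFun (hE t ht (planeWave ξ) (contDiff_planeWave ξ)) 0
  simp only [dilation, map_zero] at h
  exact h

end Operators

/-! ### Anisotropic estimates for homogeneous polynomials -/

section Anisotropic

variable {d : ℕ}

/-- The anisotropic size `∑_k |z_k|^{2 m_k}` of a vector `z ∈ ℂ^d`. -/
def anisoSize (m : Fin d → ℕ) (z : Fin d → ℂ) : ℝ := ∑ k, ‖z k‖ ^ (2 * m k)

/-- The vector of imaginary parts, viewed in `ℂ^d`. -/
def imPart (z : Fin d → ℂ) : Fin d → ℂ := fun k => ((z k).im : ℂ)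

/-- The anisotropic dilation `z ↦ (t^{1/(2 m_k)} z_k)_k`. -/
def anisoDilate (m : Fin d → ℕ) (t : ℝ) (z : Fin d → ℂ) : Fin d → ℂ :=
  fun k => ((t ^ (1 / (2 * m k : ℝ)) : ℝ) : ℂ) * z k

variable {m : Fin d → ℕ}

theorem anisoSize_nonneg (m : Fin d → ℕ) (z : Fin d → ℂ) : 0 ≤ anisoSize m z :=
  Finset.sum_nonneg fun _ _ => by positivity

theorem continuous_anisoSize (m : Fin d → ℕ) : Continuous (anisoSize m) := by
  unfold anisoSize
  fun_prop

theorem norm_pow_le_anisoSize (m : Fin d → ℕ) (z : Fin d → ℂ) (k : Fin d) :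
    ‖z k‖ ^ (2 * m k) ≤ anisoSize m z :=
  Finset.single_le_sum (f := fun k => ‖z k‖ ^ (2 * m k)) (fun _ _ => by positivity)
    (Finset.mem_univ k)

theorem anisoSize_mono (m : Fin d → ℕ) {z w : Fin d → ℂ} (h : ∀ k, ‖z k‖ ≤ ‖w k‖) :
    anisoSize m z ≤ anisoSize m w :=
  Finset.sum_le_sum fun k _ => pow_le_pow_left₀ (norm_nonneg _) (h k) _

theorem anisoSize_eq_zero (hm : ∀ k, 0 < m k) {z : Fin d → ℂ} (h : anisoSize m z = 0) : z = 0 := by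
  funext k
  have h1 := norm_pow_le_anisoSize m z k
  rw [h] at h1
  have h2 : ‖z k‖ ^ (2 * m k) = 0 := le_antisymm h1 (by positivity)
  simpa using (pow_eq_zero_iff (by have := hm k; omega)).1 h2

theorem anisoSize_dilate (hm : ∀ k, 0 < m k) {t : ℝ} (ht : 0 < t) (z : Fin d → ℂ) :
    anisoSize m (anisoDilate m t z) = t * anisoSize m z := by
  simp only [anisoSize, anisoDilate, Finset.mul_sum]
  refine Finset.sum_congr rfl fun k _ => ?_
  have hk : (0 : ℝ) < m k := by exact_mod_cast hm k
  rw [norm_mul, mul_pow, Complex.norm_real, Real.norm_of_nonneg (by positivity),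
    ← Real.rpow_natCast, ← Real.rpow_mul ht.le]
  congr 1
  push_cast
  rw [one_div_mul_cancel (by positivity), Real.rpow_one]

/-- Up to a constant, the anisotropic size is subadditive. -/
theorem exists_anisoSize_add_le (m : Fin d → ℕ) :
    ∃ B : ℝ, 0 < B ∧ ∀ z w, anisoSize m (z + w) ≤ B * (anisoSize m z + anisoSize m w) := by
  refine ⟨1 + ∑ k, 2 ^ (2 * m k - 1), by positivity, fun z w => ?_⟩
  rw [anisoSize, anisoSize, anisoSize, ← Finset.sum_add_distrib, Finset.mul_sum]
  refine Finset.sum_le_sum fun k _ => ?_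
  calc ‖(z + w) k‖ ^ (2 * m k) ≤ (‖z k‖ + ‖w k‖) ^ (2 * m k) :=
        pow_le_pow_left₀ (norm_nonneg _) (norm_add_le _ _) _
    _ ≤ 2 ^ (2 * m k - 1) * (‖z k‖ ^ (2 * m k) + ‖w k‖ ^ (2 * m k)) :=
        add_pow_le (norm_nonneg _) (norm_nonneg _) _
    _ ≤ _ := by
        gcongr
        have := Finset.single_le_sum (f := fun k => (2 : ℝ) ^ (2 * m k - 1))
          (fun _ _ => by positivity) (Finset.mem_univ k)
        linarith

theorem wt_nonneg (β n : Fin d → ℕ) : 0 ≤ wt β n := Finset.sum_nonneg fun _ _ => by positivity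

theorem wt_two_mul (β m : Fin d → ℕ) : wt β (fun j => 2 * m j) = wt β m / 2 := by
  simp only [wt, Finset.sum_div]
  refine Finset.sum_congr rfl fun k _ => ?_
  push_cast
  rw [div_div, mul_comm]

theorem norm_monomial_le (hm : ∀ k, 0 < m k) (β : Fin d → ℕ) (z : Fin d → ℂ) :
    ‖∏ k, z k ^ β k‖ ≤ anisoSize m z ^ wt β (fun j => 2 * m j) := by
  have h0 := anisoSize_nonneg m z
  rw [wt, Real.rpow_sum_of_nonneg h0 (fun _ _ => by positivity), norm_prod]
  refine Finset.prod_le_prod (fun _ _ => norm_nonneg _) fun k _ => ?_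
  have hk : (0 : ℝ) < m k := by exact_mod_cast hm k
  have h1 : ‖z k‖ = (‖z k‖ ^ (2 * m k)) ^ (1 / ((2 * m k : ℕ) : ℝ)) := by
    rw [← Real.rpow_natCast, ← Real.rpow_mul (norm_nonneg _), mul_one_div_cancel, Real.rpow_one]
    push_cast; positivity
  rw [norm_pow, div_eq_inv_mul, Real.rpow_mul h0, Real.rpow_natCast, ← one_div]
  refine pow_le_pow_left₀ (norm_nonneg _) ?_ _
  rw [h1]
  exact Real.rpow_le_rpow (by positivity) (norm_pow_le_anisoSize m z k) (by positivity)

theorem continuous_polyFun (a : (Fin d → ℕ) →₀ ℂ) : Continuous (polyFun a) := by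
  unfold polyFun Finsupp.sum
  fun_prop

theorem polyFun_dilate {a : (Fin d → ℕ) →₀ ℂ}
    (ha : ∀ β ∈ a.support, wt β m = 2) {t : ℝ} (ht : 0 < t) (z : Fin d → ℂ) :
    polyFun a (anisoDilate m t z) = t * polyFun a z := by
  simp only [polyFun, Finsupp.sum, Finset.mul_sum]
  refine Finset.sum_congr rfl fun β hβ => ?_
  have h1 : ∏ k, ((t ^ (1 / (2 * m k : ℝ)) : ℝ) : ℂ) ^ β k = t := by
    have h2 : ∏ k, (t ^ (1 / (2 * m k : ℝ)) : ℝ) ^ β k = t := by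
      calc ∏ k, (t ^ (1 / (2 * m k : ℝ)) : ℝ) ^ β k
          = ∏ k, t ^ ((β k : ℝ) / ((2 * m k : ℕ) : ℝ)) := by
            refine Finset.prod_congr rfl fun k _ => ?_
            rw [← Real.rpow_natCast, ← Real.rpow_mul ht.le]
            push_cast
            ring_nf
        _ = t ^ wt β (fun j => 2 * m j) := (Real.rpow_sum_of_pos ht _ _).symm
        _ = t := by rw [wt_two_mul, ha β hβ]; simp
    exact_mod_cast congrArg (fun x : ℝ => (x : ℂ)) h2
  simp only [anisoDilate, mul_pow, Finset.prod_mul_distrib, h1]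
  ring

theorem exists_norm_polyFun_le (hm : ∀ k, 0 < m k) {a : (Fin d → ℕ) →₀ ℂ}
    (ha : ∀ β ∈ a.support, wt β m = 2) :
    ∃ A : ℝ, 0 < A ∧ ∀ z, ‖polyFun a z‖ ≤ A * anisoSize m z := by
  refine ⟨1 + ∑ β ∈ a.support, ‖a β‖, by positivity, fun z => ?_⟩
  have h0 := anisoSize_nonneg m z
  calc ‖polyFun a z‖ ≤ ∑ β ∈ a.support, ‖a β * ∏ k, z k ^ β k‖ := norm_sum_le _ _
    _ ≤ ∑ β ∈ a.support, ‖a β‖ * anisoSize m z := by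
        refine Finset.sum_le_sum fun β hβ => ?_
        rw [norm_mul]
        gcongr
        refine (norm_monomial_le hm β z).trans ?_
        rw [wt_two_mul, ha β hβ]
        simp
    _ = (∑ β ∈ a.support, ‖a β‖) * anisoSize m z := by rw [Finset.sum_mul]
    _ ≤ _ := by gcongr; linarith

theorem isCompact_anisoSphere (hm : ∀ k, 0 < m k) : IsCompact {z | anisoSize m z = 1} := by
  refine (isCompact_closedBall (0 : Fin d → ℂ) 1).of_isClosed_subset
    (isClosed_eq (continuous_anisoSize m) continuous_const) fun z hz => ?_
  rw [mem_closedBall_zero_iff, pi_norm_le_iff_of_nonneg zero_le_one]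
  intro k
  have h1 := norm_pow_le_anisoSize m z k
  rw [show anisoSize m z = 1 from hz] at h1
  exact (pow_le_one_iff_of_nonneg (norm_nonneg _) (by have := hm k; omega)).1 h1

/-- The Gårding-type inequality behind the off-diagonal estimates: a homogeneous polynomial with
positive real part on `ℝ^d ∖ {0}` satisfies `Re p(z) ≥ ε |z|_m - C |Im z|_m` on `ℂ^d`, where
`|·|_m` is the anisotropic size. By homogeneity only the compact set `|z|_m = 1` matters; there
`Im z` stays away from `0` wherever `Re p ≤ 0`. -/
theorem exists_le_re_polyFun (hm : ∀ k, 0 < m k) {a : (Fin d → ℕ) →₀ ℂ}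
    (ha : ∀ β ∈ a.support, wt β m = 2)
    (hpos : ∀ z : Fin d → ℂ, imPart z = 0 → z ≠ 0 → 0 < (polyFun a z).re) :
    ∃ ε C : ℝ, 0 < ε ∧ 0 < C ∧
      ∀ z, ε * anisoSize m z ≤ (polyFun a z).re + C * anisoSize m (imPart z) := by
  have hS := isCompact_anisoSphere hm
  have hpc : Continuous fun z => (polyFun a z).re :=
    Complex.continuous_re.comp (continuous_polyFun a)
  have hic : Continuous fun z : Fin d → ℂ => anisoSize m (imPart z) := by
    refine (continuous_anisoSize m).comp ?_
    unfold imPart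
    fun_prop
  obtain ⟨A, hA, hAb⟩ := exists_norm_polyFun_le hm ha
  have hK : IsCompact ({z | anisoSize m z = 1} ∩ {z | (polyFun a z).re ≤ 0}) :=
    hS.inter_right (isClosed_le hpc continuous_const)
  obtain ⟨δ, hδ, hδb⟩ := hK.exists_forall_le' (a := 0) hic.continuousOn fun z hz => by
    refine (anisoSize_nonneg m _).lt_of_ne fun h => ?_
    have hz0 : z ≠ 0 := by
      rintro rfl
      have h1 : anisoSize m (0 : Fin d → ℂ) = 1 := hz.1
      have h2 : anisoSize m (0 : Fin d → ℂ) = 0 := by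
        refine Finset.sum_eq_zero fun k _ => ?_
        have := hm k
        simp only [Pi.zero_apply, norm_zero]
        exact zero_pow (by omega)
      linarith
    exact absurd hz.2 (not_le.2 (hpos z (anisoSize_eq_zero hm h.symm) hz0))
  have hC : 0 < (A + 1) / δ := by positivity
  obtain ⟨ε, hε, hεb⟩ := hS.exists_forall_le' (a := 0)
    (f := fun z => (polyFun a z).re + (A + 1) / δ * anisoSize m (imPart z))
    (hpc.add (continuous_const.mul hic)).continuousOn fun z hz => by
      rcases le_or_gt (polyFun a z).re 0 with h | h
      · have h1 := hδb z ⟨hz, h⟩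
        have h2 : A + 1 ≤ (A + 1) / δ * anisoSize m (imPart z) := by
          calc A + 1 = (A + 1) / δ * δ := by field_simp
            _ ≤ _ := by gcongr
        have h3 := (Complex.abs_re_le_norm _).trans (hAb z)
        rw [show anisoSize m z = 1 from hz, mul_one] at h3
        linarith [(abs_le.1 h3).1]
      · have := mul_nonneg hC.le (anisoSize_nonneg m (imPart z))
        linarith
  refine ⟨ε, (A + 1) / δ, hε, hC, fun z => ?_⟩
  rcases (anisoSize_nonneg m z).eq_or_lt with h | h
  · have hz := anisoSize_eq_zero hm h.symm
    have h1 := (hAb z)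
    rw [← h, mul_zero] at h1
    have h2 : polyFun a z = 0 := norm_le_zero_iff.1 h1
    rw [← h, h2]
    have := mul_nonneg hC.le (anisoSize_nonneg m (imPart z))
    simpa using this
  · set t := anisoSize m z
    have hsz : anisoSize m (anisoDilate m t⁻¹ z) = 1 := by
      rw [anisoSize_dilate hm (inv_pos.2 h)]
      exact inv_mul_cancel₀ h.ne'
    have h1 := hεb _ hsz
    have him : imPart (anisoDilate m t⁻¹ z) = anisoDilate m t⁻¹ (imPart z) := by
      funext k
      simp only [imPart, anisoDilate, Complex.im_ofReal_mul]
      push_cast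
      ring
    rw [him, anisoSize_dilate hm (inv_pos.2 h), polyFun_dilate ha (inv_pos.2 h),
      Complex.re_ofReal_mul] at h1
    calc ε * t ≤ (t⁻¹ * (polyFun a z).re + (A + 1) / δ * (t⁻¹ * anisoSize m (imPart z))) * t := by
          gcongr
      _ = _ := by field_simp

theorem rpow_le_rpow_self_mul_exp {x w : ℝ} (hx : 0 ≤ x) (hw : 0 ≤ w) :
    x ^ w ≤ w ^ w * Real.exp x := by
  rcases hw.eq_or_lt with rfl | hw
  · simpa using hx
  · have h1 : x / w ≤ Real.exp (x / w) := by linarith [Real.add_one_le_exp (x / w)]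
    calc x ^ w = (w * (x / w)) ^ w := by rw [mul_div_cancel₀ _ hw.ne']
      _ = w ^ w * (x / w) ^ w := Real.mul_rpow hw.le (by positivity)
      _ ≤ w ^ w * Real.exp (x / w) ^ w := by gcongr
      _ = w ^ w * Real.exp x := by rw [← Real.exp_mul, div_mul_cancel₀ _ hw.ne']

theorem pow_le_factorial_mul_exp {x : ℝ} (hx : 0 ≤ x) (k : ℕ) :
    x ^ k ≤ k.factorial * Real.exp x := by
  have := Real.pow_div_factorial_le_exp x hx k
  rwa [div_le_iff₀' (by positivity)] at this

/-- The pointwise bound for the complexified integrand. A third of the exponential decay absorbs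
`|z^β|`, a third absorbs `|p(z)|^k` at the price of `k!`, and a third is kept. -/
theorem norm_integrand_le (hm : ∀ k, 0 < m k) {a : (Fin d → ℕ) →₀ ℂ} {A ε C : ℝ} (hA : 0 < A)
    (hAb : ∀ z, ‖polyFun a z‖ ≤ A * anisoSize m z) (hε : 0 < ε)
    (hre : ∀ z, ε * anisoSize m z ≤ (polyFun a z).re + C * anisoSize m (imPart z))
    (β : Fin d → ℕ) (k : ℕ) {t : ℝ} (ht : 0 < t) (z : Fin d → ℂ) :
    ‖∏ j, z j ^ β j‖ * ‖polyFun a z‖ ^ k * Real.exp (-(t * (polyFun a z).re)) ≤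
      (wt β (fun j => 2 * m j) / (ε / 3)) ^ wt β (fun j => 2 * m j) * (A / (ε / 3)) ^ k *
        k.factorial / t ^ (k + wt β (fun j => 2 * m j)) *
          (Real.exp (-(t * (ε / 3) * anisoSize m z)) *
            Real.exp (t * C * anisoSize m (imPart z))) := by
  set w := wt β (fun j => 2 * m j)
  set s := anisoSize m z
  set r := anisoSize m (imPart z)
  have hs : 0 ≤ s := anisoSize_nonneg m z
  have hw : 0 ≤ w := wt_nonneg _ _
  set y := t * (ε / 3) * s with hy
  have hte : 0 < t * (ε / 3) := by positivity
  have hy0 : 0 ≤ y := by positivity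
  have hsy : s = y / (t * (ε / 3)) := by rw [hy]; field_simp
  have h1 : ‖∏ j, z j ^ β j‖ ≤ (w / (t * (ε / 3))) ^ w * Real.exp y := by
    calc ‖∏ j, z j ^ β j‖ ≤ s ^ w := norm_monomial_le hm β z
      _ = y ^ w / (t * (ε / 3)) ^ w := by rw [hsy, Real.div_rpow hy0 hte.le]
      _ ≤ w ^ w * Real.exp y / (t * (ε / 3)) ^ w := by
          gcongr; exact rpow_le_rpow_self_mul_exp hy0 hw
      _ = _ := by rw [Real.div_rpow hw hte.le]; ring
  have h2 : ‖polyFun a z‖ ^ k ≤ (A / (t * (ε / 3))) ^ k * (k.factorial * Real.exp y) := by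
    calc ‖polyFun a z‖ ^ k ≤ (A * s) ^ k := by gcongr; exact hAb z
      _ = (A / (t * (ε / 3))) ^ k * y ^ k := by rw [hsy, ← mul_pow]; ring
      _ ≤ _ := by gcongr; exact pow_le_factorial_mul_exp hy0 k
  have h3 : Real.exp (-(t * (polyFun a z).re)) ≤ Real.exp (-(3 * y)) * Real.exp (t * C * r) := by
    rw [← Real.exp_add, Real.exp_le_exp]
    have := mul_le_mul_of_nonneg_left (hre z) ht.le
    calc -(t * (polyFun a z).re) ≤ -(t * (ε * s)) + t * (C * r) := by linarith
      _ = _ := by rw [hy]; ring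
  calc _ ≤ (w / (t * (ε / 3))) ^ w * Real.exp y *
        ((A / (t * (ε / 3))) ^ k * (k.factorial * Real.exp y)) *
          (Real.exp (-(3 * y)) * Real.exp (t * C * r)) := by gcongr
    _ = (w / (t * (ε / 3))) ^ w * (A / (t * (ε / 3))) ^ k * k.factorial *
          ((Real.exp y * Real.exp y * Real.exp (-(3 * y))) * Real.exp (t * C * r)) := by ring
    _ = (w / (t * (ε / 3))) ^ w * (A / (t * (ε / 3))) ^ k * k.factorial *
          (Real.exp (-y) * Real.exp (t * C * r)) := by
        rw [← Real.exp_add, ← Real.exp_add]; ring_nf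
    _ = _ := by
        rw [Real.rpow_add ht, Real.rpow_natCast, mul_comm t (ε / 3), ← div_div w,
          Real.div_rpow (by positivity) ht.le, ← div_div A, div_pow (A / (ε / 3)) t k]
        field_simp

end Anisotropic

/-! ### Existence of a representing basis and weights -/

section Representation

variable {V : Type*} [NormedAddCommGroup V] [NormedSpace ℝ V] {d : ℕ}

theorem tpow_apply_of_eigenvector [FiniteDimensional ℝ V] {E : V →L[ℝ] V} {x : V} {c : ℝ}
    (h : E x = c • x) {t : ℝ} (ht : 0 < t) : tpow t E x = t ^ c • x := by
  have : CompleteSpace V := FiniteDimensional.complete ℝ V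
  have hpow : ∀ n : ℕ, ((Real.log t • E) ^ n) x = (Real.log t * c) ^ n • x := by
    intro n
    induction n with
    | zero => simp
    | succ n ih =>
      rw [pow_succ', mul_apply_eq_comp, ih, map_smul, _root_.smul_apply, h, smul_smul, smul_smul,
        pow_succ, mul_assoc]
  have h1 := (NormedSpace.exp_series_hasSum_exp' (𝕂 := ℝ) (Real.log t • E)).mapL
    (ContinuousLinearMap.apply ℝ V x)
  have h2 := (NormedSpace.exp_series_hasSum_exp' (𝕂 := ℝ) (Real.log t * c)).smul_const x
  rw [← Real.exp_eq_exp_ℝ, ← Real.rpow_def_of_pos ht] at h2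
  refine h1.unique (h2.congr_fun fun n => ?_)
  simp [hpow, smul_smul]

/-- A polynomial in `d` variables that vanishes on `ℝ^d` has zero coefficients. -/
theorem eq_zero_of_polyFun_real_eq_zero {b : (Fin d → ℕ) →₀ ℂ}
    (h : ∀ x : Fin d → ℝ, polyFun b (fun k => (x k : ℂ)) = 0) : b = 0 := by
  classical
  let p : MvPolynomial (Fin d) ℂ :=
    ∑ β ∈ b.support, MvPolynomial.monomial (Finsupp.equivFunOnFinite.symm β) (b β)
  have heval : ∀ z : Fin d → ℂ, MvPolynomial.eval z p = polyFun b z := by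
    intro z
    simp only [p, map_sum, MvPolynomial.eval_monomial, polyFun, Finsupp.sum]
    refine Finset.sum_congr rfl fun β _ => ?_
    rw [Finsupp.prod_fintype _ _ (fun _ => pow_zero _)]
    simp
  have hp : p = 0 := by
    refine MvPolynomial.funext_set (fun _ => Set.range ((↑) : ℝ → ℂ))
      (fun _ => Set.infinite_range_of_injective Complex.ofReal_injective) fun z hz => ?_
    choose x hx using fun k => hz k (Set.mem_univ k)
    rw [heval, map_zero, ← h x]
    congr 1
    funext k
    exact (hx k).symm
  ext β
  by_contra hβ
  have hc : MvPolynomial.coeff (Finsupp.equivFunOnFinite.symm β) p = b β := by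
    simp only [p, MvPolynomial.coeff_sum, MvPolynomial.coeff_monomial,
      EmbeddingLike.apply_eq_iff_eq]
    rw [Finset.sum_ite_eq' b.support β]
    simpa using fun h' => h'.symm
  rw [hp, MvPolynomial.coeff_zero] at hc
  exact hβ hc.symm

theorem exists_coords_eq (v : Module.Basis (Fin d) ℝ V) [FiniteDimensional ℝ V] (x : Fin d → ℝ) :
    ∃ ξ : V →L[ℝ] ℝ, coords v ξ = fun k => (x k : ℂ) := by
  refine ⟨LinearMap.toContinuousLinearMap (v.constr ℝ x), ?_⟩
  funext k
  simp [coords]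

theorem re_polyFun_pos [FiniteDimensional ℝ V] {Λ : (V → ℂ) → (V → ℂ)}
    (hΛ : IsPositiveHomogeneous Λ) {v : Module.Basis (Fin d) ℝ V} {a : (Fin d → ℕ) →₀ ℂ}
    (ha : ∀ f : V → ℂ, ContDiff ℝ ∞ f → Λ f = diffOp v a f) {z : Fin d → ℂ}
    (hz : imPart z = 0) (hz0 : z ≠ 0) : 0 < (polyFun a z).re := by
  obtain ⟨ξ, hξ⟩ := exists_coords_eq v fun k => (z k).re
  have hξz : coords v ξ = z := by
    rw [hξ]
    funext k
    have := congrFun hz k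
    simp only [imPart, Pi.zero_apply, Complex.ofReal_eq_zero] at this
    exact Complex.ext (by simp) (by simp [this])
  rw [← hξz, ← symbol_eq_polyFun ha]
  refine (hΛ.re_symbol_nonneg ξ).lt_of_ne fun h => hz0 ?_
  rw [← hξz, hΛ.eq_zero_of_re_symbol ξ h.symm]
  funext k
  simp [coords]

/-- In an eigenbasis of a diagonalizable exponent with eigenvalues `c_k`, only monomials with
`∑ c_k β_k = 1` occur in the symbol. -/
theorem sum_eigenvalue_mul_eq_one [FiniteDimensional ℝ V] {Λ : (V → ℂ) → (V → ℂ)} {E : V →L[ℝ] V}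
    (hE : E ∈ exponentSet Λ) {w : Module.Basis (Fin d) ℝ V} {c : Fin d → ℝ}
    (hc : ∀ k, E (w k) = c k • w k) {a : (Fin d → ℕ) →₀ ℂ}
    (ha : ∀ f : V → ℂ, ContDiff ℝ ∞ f → Λ f = diffOp w a f) {β : Fin d → ℕ}
    (hβ : β ∈ a.support) : ∑ k, c k * β k = 1 := by
  -- Comparing coefficients in `P(ξ ∘ 2^E) = 2 P(ξ)`.
  let b : (Fin d → ℕ) →₀ ℂ := Finsupp.onFinset a.support
    (fun β => a β * ((((2 : ℝ) ^ ∑ k, c k * β k : ℝ) : ℂ) - 2)) fun β h => by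
      rw [Finsupp.mem_support_iff]
      exact left_ne_zero_of_mul h
  have hb : b = 0 := eq_zero_of_polyFun_real_eq_zero fun x => by
    obtain ⟨ξ, hξ⟩ := exists_coords_eq w x
    have hdil : coords w (ξ.comp (tpow 2 E)) =
        fun k => (((2 : ℝ) ^ c k : ℝ) : ℂ) * (x k : ℂ) := by
      funext k
      have hk := congrFun hξ k
      simp only [coords] at hk
      simp only [coords, ContinuousLinearMap.comp_apply]
      rw [tpow_apply_of_eigenvector (hc k) two_pos, map_smul, smul_eq_mul, Complex.ofReal_mul, hk]
    have h1 := symbol_comp_tpow hE (two_pos (α := ℝ)) ξ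
    rw [symbol_eq_polyFun ha, symbol_eq_polyFun ha, hξ, hdil] at h1
    have h2 : polyFun b (fun k => (x k : ℂ)) =
        polyFun a (fun k => (((2 : ℝ) ^ c k : ℝ) : ℂ) * (x k : ℂ)) -
          2 * polyFun a (fun k => (x k : ℂ)) := by
      simp only [polyFun, b]
      rw [Finsupp.onFinset_sum _ (fun β => by simp), Finsupp.sum, Finsupp.sum, Finset.mul_sum,
        ← Finset.sum_sub_distrib]
      refine Finset.sum_congr rfl fun β _ => ?_
      have h3 : (((2 : ℝ) ^ ∑ k, c k * β k : ℝ) : ℂ) =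
          ∏ k, (((2 : ℝ) ^ c k : ℝ) : ℂ) ^ β k := by
        rw [Real.rpow_sum_of_pos two_pos, Complex.ofReal_prod]
        refine Finset.prod_congr rfl fun k _ => ?_
        rw [Real.rpow_mul two_pos.le, Real.rpow_natCast, Complex.ofReal_pow]
      simp only [mul_pow, Finset.prod_mul_distrib, h3]
      ring
    rw [h2, h1]
    push_cast
    ring
  have hbβ : a β * ((((2 : ℝ) ^ ∑ k, c k * β k : ℝ) : ℂ) - 2) = 0 := DFunLike.congr_fun hb β
  have h2 := (mul_eq_zero.1 hbβ).resolve_left (Finsupp.mem_support_iff.1 hβ)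
  have h3 : (2 : ℝ) ^ (∑ k, c k * β k) = 2 ^ (1 : ℝ) := by
    rw [Real.rpow_one]
    exact_mod_cast sub_eq_zero.1 h2
  exact (Real.rpow_right_inj two_pos (by norm_num)).1 h3

/-- Positivity of `Re P` along the coordinate axes forces each eigenvalue of a diagonalizable
exponent to be `1 / (2m)` with `m` a positive integer. -/
theorem exists_eigenvalue_eq [FiniteDimensional ℝ V] {Λ : (V → ℂ) → (V → ℂ)}
    (hΛ : IsPositiveHomogeneous Λ) {w : Module.Basis (Fin d) ℝ V} {c : Fin d → ℝ}
    {a : (Fin d → ℕ) →₀ ℂ} (ha : ∀ f : V → ℂ, ContDiff ℝ ∞ f → Λ f = diffOp w a f)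
    (hac : ∀ β ∈ a.support, ∑ k, c k * β k = 1) (k : Fin d) :
    ∃ n : ℕ, 0 < n ∧ c k * (2 * n) = 1 := by
  have hpos : ∀ r : ℝ, r ≠ 0 → 0 < (polyFun a (Pi.single k (r : ℂ))).re := by
    intro r hr
    refine re_polyFun_pos hΛ ha ?_ ?_
    · funext j
      rcases eq_or_ne j k with rfl | hj
      · simp [imPart]
      · simp [imPart, hj]
    · simpa using hr
  -- A monomial that does not vanish at `r e_k` is a power of the `k`-th variable.
  have hmono : ∀ (r : ℂ) (β : Fin d → ℕ), (∃ j, j ≠ k ∧ β j ≠ 0) →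
      ∏ j, (Pi.single k r : Fin d → ℂ) j ^ β j = 0 := by
    rintro r β ⟨j, hj, hβj⟩
    refine Finset.prod_eq_zero (Finset.mem_univ j) ?_
    rw [Pi.single_eq_of_ne hj, zero_pow hβj]
  have hmono' : ∀ (r : ℂ) (β : Fin d → ℕ), (∀ j, j ≠ k → β j = 0) →
      ∏ j, (Pi.single k r : Fin d → ℂ) j ^ β j = r ^ β k := by
    intro r β h
    rw [Finset.prod_eq_single k (fun j _ hj => by rw [h j hj, pow_zero]) (by simp)]
    simp
  have hck : ∀ β ∈ a.support, (∀ j, j ≠ k → β j = 0) → c k * β k = 1 := by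
    intro β hβ h
    rw [← hac β hβ, Finset.sum_eq_single k (fun j _ hj => by simp [h j hj]) (by simp)]
  obtain ⟨β, hβ, hβk⟩ : ∃ β ∈ a.support, ∀ j, j ≠ k → β j = 0 := by
    by_contra! hcon
    have h1 := hpos 1 one_ne_zero
    have h2 : polyFun a (Pi.single k ((1 : ℝ) : ℂ)) = 0 :=
      Finset.sum_eq_zero fun β hβ => by
        beta_reduce
        rw [hmono _ β (hcon β hβ), mul_zero]
    rw [h2] at h1
    exact lt_irrefl _ h1
  have h1 := hck β hβ hβk
  have hparity : polyFun a (Pi.single k ((-1 : ℝ) : ℂ)) =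
      (-1) ^ β k * polyFun a (Pi.single k ((1 : ℝ) : ℂ)) := by
    simp only [polyFun, Finsupp.sum, Finset.mul_sum]
    refine Finset.sum_congr rfl fun γ hγ => ?_
    by_cases hγk : ∀ j, j ≠ k → γ j = 0
    · have h2 := hck γ hγ hγk
      have hc0 : c k ≠ 0 := left_ne_zero_of_mul_eq_one h1
      have h3 : γ k = β k := by
        exact_mod_cast mul_left_cancel₀ hc0 (h2.trans h1.symm)
      rw [hmono' _ γ hγk, hmono' _ γ hγk, h3]
      push_cast
      ring
    · push Not at hγk
      rw [hmono _ γ hγk, hmono _ γ hγk]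
      ring
  rcases Nat.even_or_odd (β k) with he | ho
  · obtain ⟨n, hn⟩ := he
    refine ⟨n, Nat.pos_of_ne_zero fun h0 => ?_, ?_⟩
    · rw [hn, h0] at h1
      simp at h1
    · rw [hn] at h1
      push_cast at h1
      linarith
  · have h2 := hpos (-1) (by norm_num)
    rw [hparity, ho.neg_one_pow] at h2
    have h3 := hpos 1 one_ne_zero
    simp only [neg_mul, one_mul, Complex.neg_re] at h2
    linarith

theorem IsPositiveHomogeneous.exists_isRepresentedBy [FiniteDimensional ℝ V]
    {Λ : (V → ℂ) → (V → ℂ)} (hΛ : IsPositiveHomogeneous Λ) (hd : Module.finrank ℝ V = d) :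
    ∃ (v : Module.Basis (Fin d) ℝ V) (m : Fin d → ℕ), IsRepresentedBy Λ v m := by
  obtain ⟨E, hE, e, w, c, hc⟩ := hΛ.exists_diagonalizable
  obtain rfl : e = d := by rw [← hd, Module.finrank_eq_card_basis w, Fintype.card_fin]
  obtain ⟨a, ha⟩ := hΛ.isConstCoeffPDO.isDiffOpIn w
  have hac : ∀ β ∈ a.support, ∑ k, c k * β k = 1 := fun β hβ =>
    sum_eigenvalue_mul_eq_one hE hc ha hβ
  choose m hm hcm using exists_eigenvalue_eq hΛ ha hac
  refine ⟨w, m, hm, a, fun β hβ => ?_, ha⟩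
  have h : wt β m = 2 * ∑ k, c k * β k := by
    rw [wt, Finset.mul_sum]
    refine Finset.sum_congr rfl fun k _ => ?_
    have hk : (0 : ℝ) < m k := by exact_mod_cast hm k
    rw [div_eq_iff hk.ne']
    linear_combination (-(β k : ℝ)) * hcm k
  rw [h, hac β hβ, mul_one]

end Representation

/-! ### Dilations, determinants and the homogeneous order -/

section Scaling
variable {V : Type*} [NormedAddCommGroup V] [NormedSpace ℝ V] [FiniteDimensional ℝ V]

/-- The differential of the determinant at the identity is the trace. The coefficient of `s` in
`det (1 + sA)` identifies it along straight lines, hence along every curve. -/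
theorem hasDerivAt_det_of_one {n : Type*} [Fintype n] [DecidableEq n] {M : ℝ → Matrix n n ℝ}
    {A : Matrix n n ℝ} (h0 : M 0 = 1) (hM : ∀ i j, HasDerivAt (fun s => M s i j) (A i j) 0) :
    HasDerivAt (fun s => (M s).det) A.trace 0 := by
  let D : (n → n → ℝ) → ℝ := fun N => Matrix.det (Matrix.of N)
  have hD : Differentiable ℝ D := by
    have : D = fun N : n → n → ℝ =>
        ∑ σ : Equiv.Perm n, (Equiv.Perm.sign σ : ℤ) * ∏ i, N (σ i) i := by
      funext N
      simp [D, Matrix.det_apply']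
    rw [this]
    fun_prop
  have hcurve : ∀ (N : ℝ → n → n → ℝ), N 0 = (1 : Matrix n n ℝ) →
      (∀ i j, HasDerivAt (fun s => N s i j) (A i j) 0) →
      HasDerivAt (fun s => D (N s)) (fderiv ℝ D (1 : Matrix n n ℝ) A) 0 := by
    intro N hN0 hN
    have h1 : HasDerivAt N A 0 := hasDerivAt_pi.2 fun i => hasDerivAt_pi.2 fun j => hN i j
    have h2 : HasFDerivAt D (fderiv ℝ D (1 : Matrix n n ℝ)) (N 0) := by
      rw [hN0]; exact (hD _).hasFDerivAt
    exact h2.comp_hasDerivAt 0 h1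
  have hlin : HasDerivAt (fun s : ℝ => D ((1 : Matrix n n ℝ) + s • A)) A.trace 0 := by
    have : (fun s : ℝ => D ((1 : Matrix n n ℝ) + s • A)) = fun s : ℝ => 1 + A.trace * s +
        ((Matrix.det (1 + (Polynomial.X : Polynomial ℝ) • A.map Polynomial.C)).divX.divX.eval s)
          * s ^ 2 := by
      funext s
      exact Matrix.det_one_add_smul s A
    rw [this]
    have h1 : HasDerivAt (fun s : ℝ => 1 + A.trace * s) (A.trace * 1) 0 :=
      ((hasDerivAt_id (0 : ℝ)).const_mul A.trace).const_add 1
    have h2 := (Polynomial.hasDerivAt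
      (Matrix.det (1 + (Polynomial.X : Polynomial ℝ) • A.map Polynomial.C)).divX.divX (0 : ℝ)).mul
      (hasDerivAt_pow 2 (0 : ℝ))
    exact (h1.add h2).congr_deriv (by simp)
  have hlin' := hcurve (fun s => (1 : Matrix n n ℝ) + s • A) (by
      simp only [zero_smul, add_zero]
      rfl) (fun i j => by
    have := ((hasDerivAt_id (0 : ℝ)).mul_const (A i j)).const_add ((1 : Matrix n n ℝ) i j)
    simpa using this)
  rw [hlin.unique hlin']
  exact hcurve M h0 hM

/-- Jacobi's formula `det (exp (s E)) = exp (s tr E)`, obtained from the fact that the left-hand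
side is a one-parameter multiplicative function of `s` whose derivative at `0` is `tr E`. -/
theorem det_exp_smul (E : V →L[ℝ] V) (s : ℝ) :
    LinearMap.det (NormedSpace.exp (s • E) : V →L[ℝ] V).toLinearMap =
      Real.exp (s * LinearMap.trace ℝ V (E : V →ₗ[ℝ] V)) := by
  have : CompleteSpace V := FiniteDimensional.complete ℝ V
  let _ : NormedAlgebra ℚ (V →L[ℝ] V) := NormedAlgebra.restrictScalars ℚ ℝ (V →L[ℝ] V)
  set φ : ℝ → ℝ := fun s => LinearMap.det (NormedSpace.exp (s • E) : V →L[ℝ] V).toLinearMap with hφ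
  set τ := LinearMap.trace ℝ V (E : V →ₗ[ℝ] V)
  have hadd : ∀ a b, φ (a + b) = φ a * φ b := by
    intro a b
    have hc : Commute (a • E) (b • E) := ((Commute.refl E).smul_left a).smul_right b
    simp only [hφ]
    rw [add_smul, NormedSpace.exp_add_of_commute hc, ← LinearMap.det_comp]
    rfl
  have h0 : φ 0 = 1 := by
    simp only [hφ, zero_smul, NormedSpace.exp_zero]
    exact LinearMap.det_id
  have hder0 : HasDerivAt φ τ 0 := by
    let b := Module.finBasis ℝ V
    have h := hasDerivAt_det_of_one
      (M := fun s => LinearMap.toMatrix b b (NormedSpace.exp (s • E) : V →L[ℝ] V).toLinearMap)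
      (A := LinearMap.toMatrix b b (E : V →ₗ[ℝ] V)) (by
        simp only [zero_smul, NormedSpace.exp_zero]
        exact LinearMap.toMatrix_id b) (fun i j => by
        have hE : HasDerivAt (fun s : ℝ => NormedSpace.exp (s • E)) E 0 := by
          simpa using hasDerivAt_exp_smul_const (𝕂 := ℝ) E 0
        let ℓ : (V →L[ℝ] V) →L[ℝ] ℝ :=
          (LinearMap.toContinuousLinearMap (b.coord i)).comp
            (ContinuousLinearMap.apply ℝ V (b j))
        have := ℓ.hasFDerivAt.comp_hasDerivAt 0 hE
        refine (this.congr_deriv ?_).congr_of_eventuallyEq (Filter.Eventually.of_forall fun s => ?_)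
        · simp [ℓ, LinearMap.toMatrix_apply]
        · simp [ℓ, LinearMap.toMatrix_apply])
    simp only [LinearMap.det_toMatrix] at h
    rw [← LinearMap.trace_eq_matrix_trace] at h
    exact h
  have hder : ∀ s, HasDerivAt φ (φ s * τ) s := by
    intro s
    have h1 : HasDerivAt (fun r => φ s * φ (r - s)) (φ s * τ) s := by
      have h2 : HasDerivAt φ τ (s - s) := by rwa [sub_self]
      exact (h2.comp_sub_const s s).const_mul _
    refine h1.congr_of_eventuallyEq (Filter.Eventually.of_forall fun r => ?_)
    simp only
    rw [← hadd]; ring_nf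
  have hconst : ∀ s, φ s * Real.exp (-(s * τ)) = φ 0 * Real.exp (-(0 * τ)) := by
    intro s
    have hd : ∀ r, HasDerivAt (fun r => φ r * Real.exp (-(r * τ))) 0 r := by
      intro r
      have he : HasDerivAt (fun r : ℝ => Real.exp (-(r * τ))) (Real.exp (-(r * τ)) * -(1 * τ)) r :=
        ((hasDerivAt_id r).mul_const τ).fun_neg.exp
      exact ((hder r).mul he).congr_deriv (by ring)
    exact is_const_of_deriv_eq_zero (fun r => (hd r).differentiableAt) (fun r => (hd r).deriv) s 0
  have := hconst s
  rw [h0, zero_mul, neg_zero, Real.exp_zero, mul_one, Real.exp_neg] at this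
  have hne := (Real.exp_pos (s * τ)).ne'
  field_simp at this
  exact this

theorem det_tpow (E : V →L[ℝ] V) {t : ℝ} (ht : 0 < t) :
    LinearMap.det (tpow t E).toLinearMap = t ^ (LinearMap.trace ℝ V (E : V →ₗ[ℝ] V)) := by
  rw [tpow, det_exp_smul, Real.rpow_def_of_pos ht]

/-- Precomposition with `A`, as a linear endomorphism of `V*`. -/
def precomp (A : V →L[ℝ] V) : (V →L[ℝ] ℝ) →ₗ[ℝ] (V →L[ℝ] ℝ) where
  toFun ξ := ξ.comp A
  map_add' _ _ := rfl
  map_smul' _ _ := rfl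

theorem det_precomp (A : V →L[ℝ] V) : LinearMap.det (precomp A) = LinearMap.det A.toLinearMap := by
  let e : (V →ₗ[ℝ] ℝ) ≃ₗ[ℝ] (V →L[ℝ] ℝ) := LinearMap.toContinuousLinearMap
  have h : precomp A = e.toLinearMap ∘ₗ (A.toLinearMap.dualMap) ∘ₗ e.symm.toLinearMap := by
    ext ξ x
    rfl
  rw [h, LinearMap.det_conj]
  exact LinearMap.det_dualMap _

/-- If `F(ξ ∘ t^E) = t F(ξ)` then `∫ e^{-a t F} = t^{-tr E} ∫ e^{-a F}`. -/
theorem integral_exp_neg_mul_of_homogeneous (ν : Measure (V →L[ℝ] ℝ)) [ν.IsAddHaarMeasure]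
    {F : (V →L[ℝ] ℝ) → ℝ} (E : V →L[ℝ] V) (a : ℝ) {t : ℝ} (ht : 0 < t)
    (hF : ∀ ξ, F (ξ.comp (tpow t E)) = t * F ξ) :
    ∫ ξ, Real.exp (-(a * (t * F ξ))) ∂ν =
      t ^ (-(LinearMap.trace ℝ V (E : V →ₗ[ℝ] V))) * ∫ ξ, Real.exp (-(a * F ξ)) ∂ν := by
  have hdet : LinearMap.det (precomp (tpow t E)) =
      t ^ (LinearMap.trace ℝ V (E : V →ₗ[ℝ] V)) := by rw [det_precomp, det_tpow E ht]
  have hpos : 0 < t ^ (LinearMap.trace ℝ V (E : V →ₗ[ℝ] V)) := Real.rpow_pos_of_pos ht _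
  have hne : LinearMap.det (precomp (tpow t E)) ≠ 0 := by rw [hdet]; exact hpos.ne'
  have hmap := Measure.map_linearMap_addHaar_eq_smul_addHaar ν hne
  let e := ((precomp (tpow t E)).equivOfDetNeZero hne).toContinuousLinearEquiv
  have he : ∀ ξ, e ξ = ξ.comp (tpow t E) := fun ξ => rfl
  have hint : ∫ ξ, Real.exp (-(a * F (ξ.comp (tpow t E)))) ∂ν =
      ∫ η, Real.exp (-(a * F η)) ∂(ν.map (precomp (tpow t E))) :=
    (e.toHomeomorph.toMeasurableEquiv.measurableEmbedding.integral_map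
      (fun η => Real.exp (-(a * F η)))).symm
  simp only [← hF]
  rw [hint, hmap, integral_smul_measure, hdet, Real.rpow_neg ht.le,
    abs_of_pos (inv_pos.2 hpos), ENNReal.toReal_ofReal (inv_pos.2 hpos).le, smul_eq_mul]

end Scaling

/-! ### Differentiation of heat integrals -/

section HeatIntegrals

variable {V : Type*} [NormedAddCommGroup V] [NormedSpace ℝ V]

/-- The conditions on a symbol `P` under which integrals against `e^{-iξ(x) - tP(ξ)}` depend
smoothly on `(t, x)`: both `|P|` and the norm are controlled by `Re P`, and `e^{-ε Re P}` is
integrable for each `ε > 0`. -/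
structure IsHeatSymbol (ν : Measure (V →L[ℝ] ℝ)) (P : (V →L[ℝ] ℝ) → ℂ) : Prop where
  continuous : Continuous P
  re_nonneg : ∀ ξ, 0 ≤ (P ξ).re
  integrable_exp : ∀ ε : ℝ, 0 < ε → Integrable (fun ξ => Real.exp (-(ε * (P ξ).re))) ν
  norm_le : ∃ C, ∀ ξ, ‖P ξ‖ ≤ C * (1 + (P ξ).re)
  norm_arg_le : ∃ C, ∀ ξ, ‖ξ‖ ≤ C * (1 + (P ξ).re)

/-- A continuous amplitude `q` that grows more slowly than `e^{ε Re P}` for every `ε > 0`. This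
class is closed under products, which makes it convenient for differentiating repeatedly under the
integral sign. -/
def IsAmplitude (P q : (V →L[ℝ] ℝ) → ℂ) : Prop :=
  Continuous q ∧ ∀ ε : ℝ, 0 < ε → ∃ C, ∀ ξ, ‖q ξ‖ ≤ C * Real.exp (ε * (P ξ).re)

/-- The integral `∫ q(ξ) e^{-iξ(x)} e^{-tP(ξ)} dξ`, as a function of `(t, x)`. -/
def heatInt (ν : Measure (V →L[ℝ] ℝ)) (P q : (V →L[ℝ] ℝ) → ℂ) (p : ℝ × V) : ℂ :=
  ∫ ξ, q ξ * (planeWave ξ p.2 * Complex.exp (-((p.1 : ℂ) * P ξ))) ∂ν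

theorem IsAmplitude.mul {P q r : (V →L[ℝ] ℝ) → ℂ} (hq : IsAmplitude P q) (hr : IsAmplitude P r) :
    IsAmplitude P (fun ξ => q ξ * r ξ) := by
  refine ⟨hq.1.mul hr.1, fun ε hε => ?_⟩
  obtain ⟨C, hC⟩ := hq.2 (ε / 2) (by positivity)
  obtain ⟨D, hD⟩ := hr.2 (ε / 2) (by positivity)
  refine ⟨C * D, fun ξ => ?_⟩
  calc ‖q ξ * r ξ‖ = ‖q ξ‖ * ‖r ξ‖ := norm_mul _ _
    _ ≤ (C * Real.exp (ε / 2 * (P ξ).re)) * (D * Real.exp (ε / 2 * (P ξ).re)) :=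
        mul_le_mul (hC ξ) (hD ξ) (norm_nonneg _) ((norm_nonneg _).trans (hC ξ))
    _ = C * D * (Real.exp (ε / 2 * (P ξ).re) * Real.exp (ε / 2 * (P ξ).re)) := by ring
    _ = C * D * Real.exp (ε * (P ξ).re) := by rw [← Real.exp_add]; ring_nf

theorem IsAmplitude.add {P q r : (V →L[ℝ] ℝ) → ℂ} (hq : IsAmplitude P q) (hr : IsAmplitude P r) :
    IsAmplitude P (fun ξ => q ξ + r ξ) := by
  refine ⟨hq.1.add hr.1, fun ε hε => ?_⟩
  obtain ⟨C, hC⟩ := hq.2 ε hε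
  obtain ⟨D, hD⟩ := hr.2 ε hε
  refine ⟨C + D, fun ξ => ?_⟩
  rw [add_mul]
  exact (norm_add_le _ _).trans (add_le_add (hC ξ) (hD ξ))

/-- A continuous function of at most linear growth in `Re P` is an amplitude. -/
theorem IsAmplitude.of_norm_le {P q : (V →L[ℝ] ℝ) → ℂ} (hP : ∀ ξ, 0 ≤ (P ξ).re)
    (hq : Continuous q) {C : ℝ} (h : ∀ ξ, ‖q ξ‖ ≤ C * (1 + (P ξ).re)) : IsAmplitude P q := by
  refine ⟨hq, fun ε hε => ⟨|C| * (1 + ε⁻¹), fun ξ => (h ξ).trans ?_⟩⟩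
  have h0 := hP ξ
  have h1 : 1 ≤ Real.exp (ε * (P ξ).re) := Real.one_le_exp (by positivity)
  have h2 : ε * (P ξ).re ≤ Real.exp (ε * (P ξ).re) := by
    linarith [Real.add_one_le_exp (ε * (P ξ).re)]
  have h3 : (P ξ).re ≤ ε⁻¹ * Real.exp (ε * (P ξ).re) := by
    rw [inv_mul_eq_div, le_div_iff₀ hε]; linarith
  calc C * (1 + (P ξ).re) ≤ |C| * (1 + (P ξ).re) := by gcongr; exact le_abs_self C
    _ ≤ |C| * ((1 + ε⁻¹) * Real.exp (ε * (P ξ).re)) := by gcongr; linarith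
    _ = _ := by ring

theorem norm_planeWave (ξ : V →L[ℝ] ℝ) (x : V) : ‖planeWave ξ x‖ = 1 := by
  rw [planeWave, Complex.norm_exp]
  simp

theorem norm_exp_neg_mul (t : ℝ) (z : ℂ) :
    ‖Complex.exp (-((t : ℂ) * z))‖ = Real.exp (-(t * z.re)) := by
  rw [Complex.norm_exp]
  simp

theorem continuous_planeWave_dual (x : V) : Continuous fun ξ : V →L[ℝ] ℝ => planeWave ξ x := by
  unfold planeWave
  fun_prop

namespace IsHeatSymbol

variable {ν : Measure (V →L[ℝ] ℝ)} {P q : (V →L[ℝ] ℝ) → ℂ}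

theorem isAmplitude (hP : IsHeatSymbol ν P) : IsAmplitude P P := by
  obtain ⟨C, hC⟩ := hP.norm_le
  exact .of_norm_le hP.re_nonneg hP.continuous hC

theorem isAmplitude_const (hP : IsHeatSymbol ν P) (c : ℂ) : IsAmplitude P (fun _ => c) := by
  refine .of_norm_le hP.re_nonneg continuous_const (C := ‖c‖) fun ξ => ?_
  have := mul_nonneg (norm_nonneg c) (hP.re_nonneg ξ)
  linarith

theorem isAmplitude_norm (hP : IsHeatSymbol ν P) : IsAmplitude P (fun ξ => (‖ξ‖ : ℂ)) := by
  obtain ⟨C, hC⟩ := hP.norm_arg_le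
  exact .of_norm_le hP.re_nonneg (by fun_prop) (C := C) fun ξ => by simpa using hC ξ

theorem isAmplitude_apply (hP : IsHeatSymbol ν P) (u : V) :
    IsAmplitude P (fun ξ => (ξ u : ℂ)) := by
  obtain ⟨C, hC⟩ := hP.norm_arg_le
  refine .of_norm_le hP.re_nonneg (by fun_prop) (C := C * ‖u‖) fun ξ => ?_
  rw [Complex.norm_real]
  calc ‖ξ u‖ ≤ ‖ξ‖ * ‖u‖ := ξ.le_opNorm u
    _ ≤ C * (1 + (P ξ).re) * ‖u‖ := by gcongr; exact hC ξ
    _ = _ := by ring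

theorem secondCountable_dual [FiniteDimensional ℝ V] : SecondCountableTopology (V →L[ℝ] ℝ) :=
  have : ProperSpace (V →L[ℝ] ℝ) := FiniteDimensional.proper ℝ _
  inferInstance

theorem integrable [FiniteDimensional ℝ V] (hP : IsHeatSymbol ν P) (hq : IsAmplitude P q)
    {t : ℝ} (ht : 0 < t) (x : V) :
    Integrable (fun ξ => q ξ * (planeWave ξ x * Complex.exp (-((t : ℂ) * P ξ)))) ν := by
  have := secondCountable_dual (V := V)
  obtain ⟨C, hC⟩ := hq.2 (t / 2) (by positivity)
  have hcont : Continuous fun ξ => q ξ * (planeWave ξ x * Complex.exp (-((t : ℂ) * P ξ))) := by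
    have := hP.continuous
    exact hq.1.mul ((continuous_planeWave_dual x).mul (by fun_prop))
  refine ((hP.integrable_exp (t / 2) (by positivity)).const_mul C).mono'
    hcont.aestronglyMeasurable (Filter.Eventually.of_forall fun ξ => ?_)
  rw [norm_mul, norm_mul, norm_planeWave, norm_exp_neg_mul, one_mul]
  calc ‖q ξ‖ * Real.exp (-(t * (P ξ).re)) ≤
      C * Real.exp (t / 2 * (P ξ).re) * Real.exp (-(t * (P ξ).re)) := by gcongr; exact hC ξ
    _ = C * Real.exp (-(t / 2 * (P ξ).re)) := by
      rw [mul_assoc, ← Real.exp_add]; ring_nf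

/-- The differential of the exponent `-iξ(x) - tP(ξ)` with respect to `(t, x)`. -/
def phaseCLM (P : (V →L[ℝ] ℝ) → ℂ) (ξ : V →L[ℝ] ℝ) : ℝ × V →L[ℝ] ℂ :=
  -(Complex.I • Complex.ofRealCLM.comp (ξ.comp (ContinuousLinearMap.snd ℝ ℝ V))) +
    -(P ξ • Complex.ofRealCLM.comp (ContinuousLinearMap.fst ℝ ℝ V))

theorem norm_phaseCLM_le (ξ : V →L[ℝ] ℝ) : ‖phaseCLM P ξ‖ ≤ ‖ξ‖ + ‖P ξ‖ := by
  refine ContinuousLinearMap.opNorm_le_bound _ (by positivity) fun p => ?_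
  simp only [phaseCLM, _root_.add_apply, _root_.neg_apply, _root_.smul_apply,
    ContinuousLinearMap.comp_apply, Complex.ofRealCLM_apply, ContinuousLinearMap.coe_snd',
    ContinuousLinearMap.coe_fst', smul_eq_mul]
  refine (norm_add_le _ _).trans ?_
  rw [norm_neg, norm_neg, norm_mul, norm_mul, Complex.norm_I, one_mul, Complex.norm_real,
    Complex.norm_real, add_mul]
  have h1 : ‖ξ p.2‖ ≤ ‖ξ‖ * ‖p‖ := (ξ.le_opNorm _).trans (by gcongr; exact norm_snd_le p)
  have h2 : ‖P ξ‖ * ‖p.1‖ ≤ ‖P ξ‖ * ‖p‖ := by gcongr; exact norm_fst_le p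
  exact add_le_add h1 h2

/-- Differentiating under the integral sign in `(t, x)` gives integrals of the same kind. -/
theorem hasFDerivAt_heatInt [FiniteDimensional ℝ V] (hP : IsHeatSymbol ν P)
    (hq : IsAmplitude P q) {p : ℝ × V} (hp : 0 < p.1) :
    ∃ L : ℝ × V →L[ℝ] ℂ, HasFDerivAt (heatInt ν P q) L p ∧ ∀ w : ℝ × V,
      L w = heatInt ν P (fun ξ => q ξ * phaseCLM P ξ w) p := by
  have := secondCountable_dual (V := V)
  have hPc := hP.continuous
  obtain ⟨C, hC⟩ := (hq.mul (hP.isAmplitude_norm)).2 (p.1 / 4) (by positivity)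
  obtain ⟨D, hD⟩ := (hq.mul (hP.isAmplitude)).2 (p.1 / 4) (by positivity)
  let F : ℝ × V → (V →L[ℝ] ℝ) → ℂ := fun p ξ =>
    q ξ * (planeWave ξ p.2 * Complex.exp (-((p.1 : ℂ) * P ξ)))
  let F' : ℝ × V → (V →L[ℝ] ℝ) → (ℝ × V →L[ℝ] ℂ) := fun p ξ => F p ξ • phaseCLM P ξ
  have hFc : ∀ p, Continuous (F p) := fun p =>
    hq.1.mul ((continuous_planeWave_dual p.2).mul (by fun_prop))
  have hs : {p' : ℝ × V | p.1 / 2 < p'.1} ∈ nhds p :=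
    (isOpen_lt continuous_const continuous_fst).mem_nhds
      (by simp only [Set.mem_ofPred_eq]; linarith)
  have hLc : Continuous (phaseCLM P : (V →L[ℝ] ℝ) → ℝ × V →L[ℝ] ℂ) := by
    unfold phaseCLM
    fun_prop
  have hF'c : Continuous (F' p) := (hFc p).smul hLc
  have hbound : ∀ ξ, ∀ p' ∈ {p' : ℝ × V | p.1 / 2 < p'.1}, ‖F' p' ξ‖ ≤
      (C + D) * Real.exp (-(p.1 / 4 * (P ξ).re)) := by
    intro ξ p' hp'
    have hp'' : p.1 / 2 < p'.1 := hp'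
    have h0 := hP.re_nonneg ξ
    simp only [F', F]
    rw [norm_smul, norm_mul, norm_mul, norm_planeWave, norm_exp_neg_mul, one_mul]
    have h1 : ‖q ξ‖ * ‖ξ‖ ≤ C * Real.exp (p.1 / 4 * (P ξ).re) := by simpa using hC ξ
    have h2 : ‖q ξ‖ * ‖P ξ‖ ≤ D * Real.exp (p.1 / 4 * (P ξ).re) := by simpa using hD ξ
    calc ‖q ξ‖ * Real.exp (-(p'.1 * (P ξ).re)) * ‖phaseCLM P ξ‖
        ≤ ‖q ξ‖ * Real.exp (-(p.1 / 2 * (P ξ).re)) * (‖ξ‖ + ‖P ξ‖) := by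
          gcongr; exact norm_phaseCLM_le ξ
      _ = (‖q ξ‖ * ‖ξ‖ + ‖q ξ‖ * ‖P ξ‖) * Real.exp (-(p.1 / 2 * (P ξ).re)) := by ring
      _ ≤ (C * Real.exp (p.1 / 4 * (P ξ).re) + D * Real.exp (p.1 / 4 * (P ξ).re)) *
            Real.exp (-(p.1 / 2 * (P ξ).re)) := by gcongr
      _ = (C + D) * (Real.exp (p.1 / 4 * (P ξ).re) * Real.exp (-(p.1 / 2 * (P ξ).re))) := by ring
      _ = _ := by rw [← Real.exp_add]; ring_nf
  have hbi : Integrable (fun ξ => (C + D) * Real.exp (-(p.1 / 4 * (P ξ).re))) ν :=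
    (hP.integrable_exp (p.1 / 4) (by positivity)).const_mul _
  have hdiff : ∀ ξ, ∀ p' : ℝ × V, HasFDerivAt (F · ξ) (F' p' ξ) p' := by
    intro ξ p'
    have h1 : HasFDerivAt (fun p : ℝ × V => -(Complex.I * (ξ p.2 : ℂ)) + -((p.1 : ℂ) * P ξ))
        (phaseCLM P ξ) p' := by
      have ha : HasFDerivAt (fun p : ℝ × V => (ξ p.2 : ℂ))
        (Complex.ofRealCLM.comp (ξ.comp (ContinuousLinearMap.snd ℝ ℝ V))) p' :=
        (Complex.ofRealCLM.comp (ξ.comp (ContinuousLinearMap.snd ℝ ℝ V))).hasFDerivAt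
      have hb : HasFDerivAt (fun p : ℝ × V => (p.1 : ℂ))
        (Complex.ofRealCLM.comp (ContinuousLinearMap.fst ℝ ℝ V)) p' :=
        (Complex.ofRealCLM.comp (ContinuousLinearMap.fst ℝ ℝ V)).hasFDerivAt
      exact (ha.const_mul Complex.I).fun_neg.fun_add (hb.mul_const (P ξ)).fun_neg
    have h2 := h1.cexp.const_mul (q ξ)
    simp only [Complex.exp_add] at h2
    refine h2.congr_fderiv ?_
    simp only [F', F, planeWave, smul_smul]
  have hF'i : Integrable (F' p) ν :=
    hbi.mono' hF'c.aestronglyMeasurable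
      (Filter.Eventually.of_forall fun ξ => hbound ξ p (mem_of_mem_nhds hs))
  have key := hasFDerivAt_integral_of_dominated_of_fderiv_le (𝕜 := ℝ) (F := F) (F' := F') hs
    (Filter.Eventually.of_forall fun p => (hFc p).aestronglyMeasurable)
    (hP.integrable hq hp p.2) hF'c.aestronglyMeasurable
    (Filter.Eventually.of_forall hbound) hbi
    (Filter.Eventually.of_forall fun ξ p' _ => hdiff ξ p')
  refine ⟨_, key, fun w => ?_⟩
  rw [ContinuousLinearMap.integral_apply hF'i]
  refine integral_congr_ae (Filter.Eventually.of_forall fun ξ => ?_)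
  simp only [F', F, _root_.smul_apply, smul_eq_mul]
  ring

theorem isAmplitude_phaseCLM (hP : IsHeatSymbol ν P) (w : ℝ × V) :
    IsAmplitude P (fun ξ => phaseCLM P ξ w) := by
  have h1 := (hP.isAmplitude_const (-Complex.I)).mul (hP.isAmplitude_apply w.2)
  have h2 := (hP.isAmplitude_const (-(w.1 : ℂ))).mul hP.isAmplitude
  convert! h1.add h2 using 2 with ξ
  simp [phaseCLM, mul_comm]

theorem contDiffOn_heatInt [FiniteDimensional ℝ V] (hP : IsHeatSymbol ν P) (hq : IsAmplitude P q) :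
    ContDiffOn ℝ ∞ (heatInt ν P q) (Set.Ioi (0 : ℝ) ×ˢ (Set.univ : Set V)) := by
  have hopen : IsOpen (Set.Ioi (0 : ℝ) ×ˢ (Set.univ : Set V)) := isOpen_Ioi.prod isOpen_univ
  rw [contDiffOn_infty]
  intro n
  induction n generalizing q with
  | zero =>
    rw [Nat.cast_zero, contDiffOn_zero]
    intro p hp
    obtain ⟨L, hL, -⟩ := hP.hasFDerivAt_heatInt hq (p := p) hp.1
    exact hL.continuousAt.continuousWithinAt
  | succ n ih =>
    rw [Nat.cast_succ, contDiffOn_succ_iff_fderiv_of_isOpen hopen]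
    refine ⟨fun p hp => ?_, by simp, contDiffOn_clm_apply.2 fun w => ?_⟩
    · obtain ⟨L, hL, -⟩ := hP.hasFDerivAt_heatInt hq (p := p) hp.1
      exact hL.differentiableAt.differentiableWithinAt
    · refine (ih (hq.mul (hP.isAmplitude_phaseCLM w))).congr fun p hp => ?_
      obtain ⟨L, hL, hLw⟩ := hP.hasFDerivAt_heatInt hq (p := p) hp.1
      rw [hL.fderiv, hLw]

theorem dirD_heatInt [FiniteDimensional ℝ V] (hP : IsHeatSymbol ν P) (hq : IsAmplitude P q)
    {t : ℝ} (ht : 0 < t) (u : V) :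
    dirD u (fun x => heatInt ν P q (t, x)) =
      fun x => heatInt ν P (fun ξ => (ξ u : ℂ) * q ξ) (t, x) := by
  funext x
  obtain ⟨L, hL, hLw⟩ := hP.hasFDerivAt_heatInt hq (p := (t, x)) ht
  have h1 : HasFDerivAt (fun x : V => heatInt ν P q (t, x))
      (L.comp (ContinuousLinearMap.inr ℝ ℝ V)) x :=
    HasFDerivAt.comp x hL (hasFDerivAt_prodMk_right t x)
  rw [dirD, (h1.hasLineDerivAt u).lineDeriv, ContinuousLinearMap.comp_apply, hLw, heatInt, heatInt,
    ← integral_const_mul]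
  refine integral_congr_ae (Filter.Eventually.of_forall fun ξ => ?_)
  simp only [phaseCLM, ContinuousLinearMap.inr_apply, _root_.add_apply, _root_.neg_apply,
    _root_.smul_apply, ContinuousLinearMap.comp_apply, ContinuousLinearMap.coe_snd',
    ContinuousLinearMap.coe_fst', map_zero, smul_eq_mul,
    Complex.ofRealCLM_apply]
  linear_combination (-(ξ u : ℂ) * q ξ * (planeWave ξ x * Complex.exp (-((t : ℂ) * P ξ)))) *
    Complex.I_mul_I

theorem isAmplitude_prod_pow (hP : IsHeatSymbol ν P) {d : ℕ} (v : Fin d → V) (β : Fin d → ℕ) :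
    IsAmplitude P (fun ξ => ∏ k, coords v ξ k ^ β k) := by
  have hpow : ∀ (u : V) (n : ℕ), IsAmplitude P (fun ξ => (ξ u : ℂ) ^ n) := by
    intro u n
    induction n with
    | zero => simpa using hP.isAmplitude_const 1
    | succ n ih => simpa only [pow_succ] using ih.mul (hP.isAmplitude_apply u)
  induction d with
  | zero => simpa using hP.isAmplitude_const 1
  | succ d ih =>
    simp only [Fin.prod_univ_succ]
    exact (hpow (v 0) (β 0)).mul (ih (fun k => v k.succ) fun k => β k.succ)

theorem isAmplitude_neg_pow (hP : IsHeatSymbol ν P) (k : ℕ) :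
    IsAmplitude P (fun ξ => (-P ξ) ^ k) := by
  induction k with
  | zero => simpa using hP.isAmplitude_const 1
  | succ n ih =>
    convert! (ih.mul hP.isAmplitude).mul (hP.isAmplitude_const (-1)) using 2 with ξ
    ring

theorem dirD_iterate_heatInt [FiniteDimensional ℝ V] (hP : IsHeatSymbol ν P)
    (hq : IsAmplitude P q) {t : ℝ} (ht : 0 < t) (u : V) (n : ℕ) :
    (dirD u)^[n] (fun x => heatInt ν P q (t, x)) =
      fun x => heatInt ν P (fun ξ => (ξ u : ℂ) ^ n * q ξ) (t, x) := by
  induction n generalizing q with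
  | zero => simp
  | succ n ih =>
    rw [Function.iterate_succ_apply, hP.dirD_heatInt hq ht,
      ih ((hP.isAmplitude_apply u).mul hq)]
    simp only [pow_succ, mul_assoc]

theorem multiD_heatInt [FiniteDimensional ℝ V] (hP : IsHeatSymbol ν P) {t : ℝ} (ht : 0 < t)
    {d : ℕ} (v : Fin d → V) (β : Fin d → ℕ) :
    multiD v β (fun x => heatInt ν P (fun _ => 1) (t, x)) =
      fun x => heatInt ν P (fun ξ => ∏ k, coords v ξ k ^ β k) (t, x) := by
  induction d with
  | zero => simp [multiD_zero]
  | succ d ih =>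
    rw [multiD_succ, ih, hP.dirD_iterate_heatInt (hP.isAmplitude_prod_pow _ _) ht]
    simp only [Fin.prod_univ_succ]
    rfl

/-- Only the values of `f` at positive times enter, since `f` need not be an integral of this kind
elsewhere. -/
theorem iteratedDeriv_heatInt [FiniteDimensional ℝ V] (hP : IsHeatSymbol ν P)
    (hq : IsAmplitude P q) {f : ℝ → ℂ} {x : V}
    (hf : ∀ s, 0 < s → f s = heatInt ν P q (s, x)) (k : ℕ) {t : ℝ} (ht : 0 < t) :
    iteratedDeriv k f t = heatInt ν P (fun ξ => (-P ξ) ^ k * q ξ) (t, x) := by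
  induction k generalizing t with
  | zero => simpa using hf t ht
  | succ k ih =>
    rw [iteratedDeriv_succ]
    have heq : iteratedDeriv k f =ᶠ[nhds t]
        fun s => heatInt ν P (fun ξ => (-P ξ) ^ k * q ξ) (s, x) := by
      filter_upwards [lt_mem_nhds ht] with s hs using ih hs
    rw [heq.deriv_eq]
    obtain ⟨L, hL, hLw⟩ := hP.hasFDerivAt_heatInt ((hP.isAmplitude_neg_pow k).mul hq)
      (p := (t, x)) ht
    have h1 : HasFDerivAt (fun s : ℝ => heatInt ν P (fun ξ => (-P ξ) ^ k * q ξ) (s, x))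
        (L.comp (ContinuousLinearMap.inl ℝ ℝ V)) t :=
      have h0 : HasFDerivAt (fun s : ℝ => (s, x)) (ContinuousLinearMap.inl ℝ ℝ V) t :=
        hasFDerivAt_prodMk_left t x
      HasFDerivAt.comp (g := heatInt ν P fun ξ => (-P ξ) ^ k * q ξ) t hL h0
    rw [h1.hasDerivAt.deriv, ContinuousLinearMap.comp_apply, hLw]
    congr 1
    funext ξ
    simp [phaseCLM]
    ring

end IsHeatSymbol

end HeatIntegrals

/-! ### Change of contour -/

section ContourShift

/-- The principle behind the change of contour: if `∫ H(w, ξ) dξ` depends holomorphically on `w`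
and takes the same value at every real `w`, then it takes that value at `w = i` too. -/
theorem integral_eq_of_forall_real {α : Type*} [TopologicalSpace α]
    [SecondCountableTopology α] [MeasurableSpace α] [BorelSpace α] {μ : Measure α}
    {H : α → ℂ → ℂ} (hc : Continuous (Function.uncurry H))
    (hd : ∀ ξ, Differentiable ℂ (H ξ)) {b : α → ℝ} (hb : Integrable b μ)
    (hHb : ∀ ξ, ∀ w ∈ Metric.ball (0 : ℂ) 3, ‖H ξ w‖ ≤ b ξ)
    (hreal : ∀ s : ℝ, ∫ ξ, H ξ (s : ℂ) ∂μ = ∫ ξ, H ξ 0 ∂μ) :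
    ∫ ξ, H ξ Complex.I ∂μ = ∫ ξ, H ξ 0 ∂μ := by
  have hcw : ∀ w, Continuous fun ξ => H ξ w := fun w =>
    hc.comp (Continuous.prodMk continuous_id continuous_const)
  have hdiff : DifferentiableOn ℂ (fun w => ∫ ξ, H ξ w ∂μ) (Metric.ball 0 2) := by
    intro w₀ hw₀
    have hmeas : AEStronglyMeasurable (fun ξ => deriv (H ξ) w₀) μ :=
      ((stronglyMeasurable_deriv_with_param hc).comp_measurable
        (measurable_id.prodMk measurable_const)).aestronglyMeasurable
    have hint : Integrable (fun ξ => H ξ w₀) μ :=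
      hb.mono' (hcw w₀).aestronglyMeasurable (Filter.Eventually.of_forall fun ξ =>
        hHb ξ w₀ (Metric.ball_subset_ball (by norm_num) hw₀))
    have hbound : ∀ ξ, ∀ w ∈ Metric.ball (0 : ℂ) 2, ‖deriv (H ξ) w‖ ≤ b ξ / (1 / 2) := by
      intro ξ w hw
      refine Complex.norm_deriv_le_of_forall_mem_sphere_norm_le (by norm_num)
        (hd ξ).diffContOnCl fun z hz => hHb ξ z ?_
      rw [mem_ball_zero_iff] at hw ⊢
      have h1 : ‖z - w‖ = 1 / 2 := by simpa [dist_eq_norm] using hz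
      calc ‖z‖ = ‖(z - w) + w‖ := by rw [sub_add_cancel]
        _ ≤ ‖z - w‖ + ‖w‖ := norm_add_le _ _
        _ < 3 := by linarith
    exact (hasDerivAt_integral_of_dominated_loc_of_deriv_le (F' := fun w ξ => deriv (H ξ) w)
      (Metric.isOpen_ball.mem_nhds hw₀)
      (Filter.Eventually.of_forall fun w => (hcw w).aestronglyMeasurable) hint hmeas
      (Filter.Eventually.of_forall hbound) (hb.div_const _)
      (Filter.Eventually.of_forall fun ξ w _ =>
        (hd ξ w).hasDerivAt)).2.differentiableAt.differentiableWithinAt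
  have han := hdiff.analyticOnNhd Metric.isOpen_ball
  have hfreq : ∃ᶠ w in nhdsWithin (0 : ℂ) {0}ᶜ, ∫ ξ, H ξ w ∂μ = ∫ ξ, H ξ 0 ∂μ := by
    have h1 : Filter.Tendsto (fun s : ℝ => (s : ℂ)) (nhdsWithin 0 {0}ᶜ)
        (nhdsWithin (0 : ℂ) {0}ᶜ) := by
      refine tendsto_nhdsWithin_of_tendsto_nhds_of_eventually_within _ ?_ ?_
      · exact (Complex.continuous_ofReal.tendsto' 0 0 (by simp)).mono_left nhdsWithin_le_nhds
      · filter_upwards [self_mem_nhdsWithin] with s hs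
        simpa using hs
    exact h1.frequently (Filter.Eventually.of_forall hreal).frequently
  exact han.eqOn_of_preconnected_of_frequently_eq analyticOnNhd_const
    (convex_ball (0 : ℂ) 2).isPreconnected (by simp) hfreq (by simp)

variable {V : Type*} [NormedAddCommGroup V] [NormedSpace ℝ V] {d : ℕ}
  {m : Fin d → ℕ}

theorem continuous_coords (v : Fin d → V) : Continuous (coords v) := by
  unfold coords
  fun_prop

theorem imPart_coords (v : Fin d → V) (ξ : V →L[ℝ] ℝ) : imPart (coords v ξ) = 0 := by
  funext k
  simp [imPart, coords]

theorem exists_norm_le_anisoSize (hm : ∀ k, 0 < m k) (v : Module.Basis (Fin d) ℝ V) :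
    ∃ B : ℝ, 0 < B ∧ ∀ ξ : V →L[ℝ] ℝ, ‖ξ‖ ≤ B * (1 + anisoSize m (coords v ξ)) := by
  obtain ⟨B, hB, h⟩ := v.exists_opNorm_le (F := ℝ)
  refine ⟨B, hB, fun ξ => h (by have := anisoSize_nonneg m (coords v ξ); linarith) fun k => ?_⟩
  have h1 := norm_pow_le_anisoSize m (coords v ξ) k
  simp only [coords, Complex.norm_real] at h1
  rcases le_total ‖ξ (v k)‖ 1 with h2 | h2
  · have := anisoSize_nonneg m (coords v ξ); linarith
  · have h3 : ‖ξ (v k)‖ ≤ ‖ξ (v k)‖ ^ (2 * m k) := by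
      simpa using pow_le_pow_right₀ h2 (show 1 ≤ 2 * m k by have := hm k; omega)
    exact (h3.trans h1).trans (by simp)

theorem integrable_exp_neg_anisoSize [FiniteDimensional ℝ V] (ν : Measure (V →L[ℝ] ℝ))
    [ν.IsAddHaarMeasure] (hm : ∀ k, 0 < m k) (v : Module.Basis (Fin d) ℝ V) {ε : ℝ}
    (hε : 0 < ε) : Integrable (fun ξ => Real.exp (-(ε * anisoSize m (coords v ξ)))) ν := by
  have := IsHeatSymbol.secondCountable_dual (V := V)
  obtain ⟨B, hB, hBb⟩ := exists_norm_le_anisoSize hm v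
  set n := Module.finrank ℝ (V →L[ℝ] ℝ) + 1
  have hint := (integrable_one_add_norm (μ := ν) (E := V →L[ℝ] ℝ) (r := (n : ℝ))
    (by simp [n])).const_mul (((1 + B) / ε) ^ n * (n.factorial * Real.exp ε))
  have hcont : Continuous fun ξ => Real.exp (-(ε * anisoSize m (coords v ξ))) := by
    have := (continuous_anisoSize m).comp (continuous_coords (V := V) v)
    exact (continuous_const.mul this).neg.rexp
  refine hint.mono' hcont.aestronglyMeasurable (Filter.Eventually.of_forall fun ξ => ?_)
  set s := anisoSize m (coords v ξ) with hs
  have hs0 : 0 ≤ s := anisoSize_nonneg _ _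
  have h1 : (1 + ‖ξ‖) ^ n ≤ ((1 + B) / ε) ^ n * (n.factorial * Real.exp ε) * Real.exp (ε * s) := by
    calc (1 + ‖ξ‖) ^ n ≤ ((1 + B) * (1 + s)) ^ n := by
          gcongr
          have := hBb ξ
          rw [← hs] at this
          linarith
      _ = ((1 + B) / ε) ^ n * (ε * (1 + s)) ^ n := by rw [← mul_pow]; congr 1; field_simp
      _ ≤ ((1 + B) / ε) ^ n * (n.factorial * Real.exp (ε * (1 + s))) := by
          gcongr; exact pow_le_factorial_mul_exp (by positivity) n
      _ = _ := by rw [mul_add, mul_one, Real.exp_add]; ring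
  rw [Real.norm_of_nonneg (Real.exp_pos _).le, Real.rpow_neg (by positivity), Real.rpow_natCast,
    Real.exp_neg]
  rw [← div_eq_mul_inv, le_div_iff₀ (by positivity), inv_mul_le_iff₀ (Real.exp_pos _)]
  linarith

theorem coords_add (v : Fin d → V) (ξ η : V →L[ℝ] ℝ) :
    coords v (ξ + η) = coords v ξ + coords v η := by
  funext k
  simp [coords]

theorem coords_smul (v : Fin d → V) (s : ℝ) (ξ : V →L[ℝ] ℝ) :
    coords v (s • ξ) = (s : ℂ) • coords v ξ := by
  funext k
  simp [coords]

/-- The integrand `z^β p(z)^k e^{-iz·x - tp(z)}` on the complexified dual space, along the complex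
line `z = ξ + wη`. -/
def complexIntegrand (v : Fin d → V) (a : (Fin d → ℕ) →₀ ℂ) (β : Fin d → ℕ) (k : ℕ) (t : ℝ) (x : V)
    (η ξ : V →L[ℝ] ℝ) (w : ℂ) : ℂ :=
  (-polyFun a (coords v ξ + w • coords v η)) ^ k *
      (∏ j, (coords v ξ + w • coords v η) j ^ β j) *
    (Complex.exp (-(Complex.I * ((ξ x : ℂ) + w * (η x : ℂ)))) *
      Complex.exp (-((t : ℂ) * polyFun a (coords v ξ + w • coords v η))))

theorem continuous_complexIntegrand (v : Fin d → V) (a : (Fin d → ℕ) →₀ ℂ) (β : Fin d → ℕ)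
    (k : ℕ) (t : ℝ) (x : V) (η : V →L[ℝ] ℝ) :
    Continuous (Function.uncurry (complexIntegrand v a β k t x η)) := by
  have h1 : Continuous fun q : (V →L[ℝ] ℝ) × ℂ => coords v q.1 + q.2 • coords v η :=
    ((continuous_coords v).comp continuous_fst).add (continuous_snd.smul continuous_const)
  have h2 := (continuous_polyFun a).comp h1
  have h3 : Continuous fun q : (V →L[ℝ] ℝ) × ℂ =>
      ∏ j, (coords v q.1 + q.2 • coords v η) j ^ β j :=
    continuous_finsetProd _ fun j _ => ((continuous_apply j).comp h1).pow _
  have h4 : Continuous fun q : (V →L[ℝ] ℝ) × ℂ =>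
      -(Complex.I * ((q.1 x : ℂ) + q.2 * (η x : ℂ))) := by fun_prop
  exact ((h2.neg.pow k).mul h3).mul (h4.cexp.mul (continuous_const.mul h2).neg.cexp)

theorem differentiable_complexIntegrand (v : Fin d → V) (a : (Fin d → ℕ) →₀ ℂ) (β : Fin d → ℕ)
    (k : ℕ) (t : ℝ) (x : V) (η ξ : V →L[ℝ] ℝ) :
    Differentiable ℂ (complexIntegrand v a β k t x η ξ) := by
  unfold complexIntegrand polyFun Finsupp.sum
  simp only [Pi.add_apply, Pi.smul_apply, smul_eq_mul]
  fun_prop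

theorem norm_complexIntegrand (v : Fin d → V) (a : (Fin d → ℕ) →₀ ℂ) (β : Fin d → ℕ)
    (k : ℕ) (t : ℝ) (x : V) (η ξ : V →L[ℝ] ℝ) (w : ℂ) :
    ‖complexIntegrand v a β k t x η ξ w‖ =
      ‖∏ j, (coords v ξ + w • coords v η) j ^ β j‖ *
          ‖polyFun a (coords v ξ + w • coords v η)‖ ^ k *
        Real.exp (-(t * (polyFun a (coords v ξ + w • coords v η)).re)) *
        Real.exp (w.im * η x) := by
  have h : ‖Complex.exp (-(Complex.I * ((ξ x : ℂ) + w * (η x : ℂ))))‖ =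
      Real.exp (w.im * η x) := by
    rw [Complex.norm_exp]
    simp
  rw [complexIntegrand, norm_mul, norm_mul, norm_mul, norm_pow, norm_neg, norm_exp_neg_mul, h]
  ring

/-- The contour `V*` may be moved to `V* + iη`. -/
theorem integral_complexIntegrand_I [FiniteDimensional ℝ V] (ν : Measure (V →L[ℝ] ℝ))
    [ν.IsAddHaarMeasure] (hm : ∀ k, 0 < m k) (v : Module.Basis (Fin d) ℝ V)
    {a : (Fin d → ℕ) →₀ ℂ} {A ε C : ℝ} (hA : 0 < A)
    (hAb : ∀ z, ‖polyFun a z‖ ≤ A * anisoSize m z) (hε : 0 < ε) (hC : 0 < C)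
    (hre : ∀ z, ε * anisoSize m z ≤ (polyFun a z).re + C * anisoSize m (imPart z))
    (β : Fin d → ℕ) (k : ℕ) {t : ℝ} (ht : 0 < t) (x : V) (η : V →L[ℝ] ℝ) :
    ∫ ξ, complexIntegrand v a β k t x η ξ Complex.I ∂ν =
      ∫ ξ, complexIntegrand v a β k t x η ξ 0 ∂ν := by
  have := IsHeatSymbol.secondCountable_dual (V := V)
  obtain ⟨B, hB, hBb⟩ := exists_anisoSize_add_le m
  set K := (wt β (fun j => 2 * m j) / (ε / 3)) ^ wt β (fun j => 2 * m j) * (A / (ε / 3)) ^ k *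
        k.factorial / t ^ (k + wt β (fun j => 2 * m j)) with hK
  have hK0 : 0 ≤ K := by
    have := wt_nonneg β (fun j => 2 * m j)
    positivity
  set S := anisoSize m ((3 : ℂ) • coords v η) with hS
  have hS0 : 0 ≤ S := anisoSize_nonneg _ _
  have hte : 0 < t * (ε / 3) := by positivity
  refine integral_eq_of_forall_real (continuous_complexIntegrand v a β k t x η)
    (differentiable_complexIntegrand v a β k t x η)
    (b := fun ξ => K * Real.exp (t * (ε / 3) * S + t * C * S + 3 * |η x|) *
      Real.exp (-(t * (ε / 3) / B * anisoSize m (coords v ξ))))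
    ((integrable_exp_neg_anisoSize ν hm v (by positivity)).const_mul _) ?_ ?_
  · intro ξ w hw
    rw [mem_ball_zero_iff] at hw
    set z := coords v ξ + w • coords v η with hz
    have hη : ∀ r : ℝ, |r| ≤ ‖w‖ → anisoSize m ((r : ℂ) • coords v η) ≤ S := by
      intro r hr
      refine anisoSize_mono m fun j => ?_
      simp only [Pi.smul_apply, norm_smul]
      gcongr
      rw [Complex.norm_real, Real.norm_eq_abs]
      simpa using hr.trans hw.le
    have him : anisoSize m (imPart z) ≤ S := by
      have : imPart z = (w.im : ℂ) • coords v η := by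
        funext j
        simp [imPart, hz, coords]
      rw [this]
      exact hη _ (Complex.abs_im_le_norm w)
    have hre' : anisoSize m (coords v ξ) ≤ B * (anisoSize m z + S) := by
      have h1 : coords v ξ =
          (fun j => ((z j).re : ℂ)) + ((-w.re : ℝ) : ℂ) • coords v η := by
        funext j
        simp [hz, coords]
      have h2 : anisoSize m (fun j => ((z j).re : ℂ)) ≤ anisoSize m z :=
        anisoSize_mono m fun j => by
          rw [Complex.norm_real]; exact Complex.abs_re_le_norm _
      have h3 := hη (-w.re) (by rw [abs_neg]; exact Complex.abs_re_le_norm w)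
      have h4 := hBb (fun j => ((z j).re : ℂ)) (((-w.re : ℝ) : ℂ) • coords v η)
      rw [← h1] at h4
      exact h4.trans (by gcongr)
    have hwη : w.im * η x ≤ 3 * |η x| := by
      calc w.im * η x ≤ |w.im * η x| := le_abs_self _
        _ = |w.im| * |η x| := abs_mul _ _
        _ ≤ 3 * |η x| := by
          gcongr
          exact (Complex.abs_im_le_norm w).trans hw.le
    have hlow : t * (ε / 3) / B * anisoSize m (coords v ξ) - t * (ε / 3) * S ≤
        t * (ε / 3) * anisoSize m z := by
      have h1 := mul_le_mul_of_nonneg_left hre' (show 0 ≤ t * (ε / 3) / B by positivity)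
      have h2 : t * (ε / 3) / B * (B * (anisoSize m z + S)) =
          t * (ε / 3) * anisoSize m z + t * (ε / 3) * S := by field_simp
      linarith
    rw [norm_complexIntegrand]
    calc _ ≤ K * (Real.exp (-(t * (ε / 3) * anisoSize m z)) *
            Real.exp (t * C * anisoSize m (imPart z))) * Real.exp (w.im * η x) :=
          mul_le_mul_of_nonneg_right (norm_integrand_le hm hA hAb hε hre β k ht z)
            (Real.exp_pos _).le
      _ = K * Real.exp (-(t * (ε / 3) * anisoSize m z) + t * C * anisoSize m (imPart z) +
            w.im * η x) := by rw [Real.exp_add, Real.exp_add]; ring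
      _ ≤ K * Real.exp (t * (ε / 3) * S + t * C * S + 3 * |η x| +
            -(t * (ε / 3) / B * anisoSize m (coords v ξ))) := by
          gcongr K * Real.exp ?_
          have : t * C * anisoSize m (imPart z) ≤ t * C * S := by gcongr
          linarith
      _ = _ := by rw [Real.exp_add _ (-_)]; ring
  · intro s
    have h : ∀ ξ, complexIntegrand v a β k t x η ξ (s : ℂ) =
        (fun ξ => complexIntegrand v a β k t x η ξ 0) (ξ + s • η) := by
      intro ξ
      simp only [complexIntegrand, coords_add, coords_smul, zero_smul, zero_mul, add_zero]
      simp
    simp only [h]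
    exact integral_add_right_eq_self (μ := ν)
      (fun ξ => complexIntegrand v a β k t x η ξ 0) (s • η)

/-- The estimate obtained on the contour `V* + iη`, before `η` is optimized. -/
theorem norm_integral_le_of_shift [FiniteDimensional ℝ V] (ν : Measure (V →L[ℝ] ℝ))
    [ν.IsAddHaarMeasure] (hm : ∀ k, 0 < m k) (v : Module.Basis (Fin d) ℝ V)
    {a : (Fin d → ℕ) →₀ ℂ} {A ε C : ℝ} (hA : 0 < A)
    (hAb : ∀ z, ‖polyFun a z‖ ≤ A * anisoSize m z) (hε : 0 < ε) (hC : 0 < C)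
    (hre : ∀ z, ε * anisoSize m z ≤ (polyFun a z).re + C * anisoSize m (imPart z))
    (β : Fin d → ℕ) (k : ℕ) {t : ℝ} (ht : 0 < t) (x : V) (η : V →L[ℝ] ℝ) :
    ‖∫ ξ, complexIntegrand v a β k t x η ξ 0 ∂ν‖ ≤
      (wt β (fun j => 2 * m j) / (ε / 3)) ^ wt β (fun j => 2 * m j) * (A / (ε / 3)) ^ k *
        k.factorial / t ^ (k + wt β (fun j => 2 * m j)) *
          Real.exp (η x + t * C * anisoSize m (coords v η)) *
        ∫ ξ, Real.exp (-(t * (ε / 3) * anisoSize m (coords v ξ))) ∂ν := by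
  set K := (wt β (fun j => 2 * m j) / (ε / 3)) ^ wt β (fun j => 2 * m j) * (A / (ε / 3)) ^ k *
        k.factorial / t ^ (k + wt β (fun j => 2 * m j)) with hK
  have hK0 : 0 ≤ K := by
    have := wt_nonneg β (fun j => 2 * m j)
    positivity
  have hte : 0 < t * (ε / 3) := by positivity
  rw [← integral_complexIntegrand_I ν hm v hA hAb hε hC hre β k ht x η, ← integral_const_mul]
  refine norm_integral_le_of_norm_le
    ((integrable_exp_neg_anisoSize ν hm v hte).const_mul _)
    (Filter.Eventually.of_forall fun ξ => ?_)
  rw [norm_complexIntegrand]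
  set z := coords v ξ + Complex.I • coords v η with hz
  have him : imPart z = coords v η := by
    funext j
    simp [imPart, hz, coords]
  have h2 : anisoSize m (coords v ξ) ≤ anisoSize m z :=
    anisoSize_mono m fun j => by
      have : coords v ξ j = ((z j).re : ℂ) := by simp [hz, coords]
      rw [this, Complex.norm_real]
      exact Complex.abs_re_le_norm _
  have h3 := norm_integrand_le hm hA hAb hε hre β k ht z
  rw [him] at h3
  calc _ ≤ K * (Real.exp (-(t * (ε / 3) * anisoSize m z)) *
            Real.exp (t * C * anisoSize m (coords v η))) * Real.exp (Complex.I.im * η x) :=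
        mul_le_mul_of_nonneg_right h3 (Real.exp_pos _).le
      _ = K * Real.exp (η x + t * C * anisoSize m (coords v η)) *
            Real.exp (-(t * (ε / 3) * anisoSize m z)) := by
          rw [Real.exp_add, Complex.I_im, one_mul]; ring
      _ ≤ _ := by gcongr

end ContourShift

/-! ### Heat kernel estimates -/

section Estimates

variable {V : Type*} [NormedAddCommGroup V] [NormedSpace ℝ V] {d : ℕ} {m : Fin d → ℕ}

theorem isHeatSymbol_symbol [FiniteDimensional ℝ V] {Λ : (V → ℂ) → (V → ℂ)}
    (hΛ : IsPositiveHomogeneous Λ) (ν : Measure (V →L[ℝ] ℝ)) [ν.IsAddHaarMeasure]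
    (hm : ∀ k, 0 < m k) {v : Module.Basis (Fin d) ℝ V} {a : (Fin d → ℕ) →₀ ℂ}
    (hsym : ∀ ξ, symbol Λ ξ = polyFun a (coords v ξ)) {A ε : ℝ} (hA : 0 < A) (hε : 0 < ε)
    (hAb : ∀ z, ‖polyFun a z‖ ≤ A * anisoSize m z)
    (hre : ∀ ξ, ε * anisoSize m (coords v ξ) ≤ (symbol Λ ξ).re) :
    IsHeatSymbol ν (symbol Λ) where
  continuous := by
    rw [show symbol Λ = fun ξ => polyFun a (coords v ξ) from funext hsym]
    exact (continuous_polyFun a).comp (continuous_coords v)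
  re_nonneg := hΛ.re_symbol_nonneg
  integrable_exp δ hδ := by
    have := IsHeatSymbol.secondCountable_dual (V := V)
    refine (integrable_exp_neg_anisoSize ν hm v (mul_pos hδ hε)).mono' ?_
      (Filter.Eventually.of_forall fun ξ => ?_)
    · refine Continuous.aestronglyMeasurable ?_
      simp only [hsym]
      exact (continuous_const.mul (Complex.continuous_re.comp
        ((continuous_polyFun a).comp (continuous_coords v)))).neg.rexp
    · rw [Real.norm_of_nonneg (Real.exp_pos _).le, Real.exp_le_exp, neg_le_neg_iff, mul_assoc]
      exact mul_le_mul_of_nonneg_left (hre ξ) hδ.le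
  norm_le := by
    refine ⟨A / ε, fun ξ => ?_⟩
    have h0 := hΛ.re_symbol_nonneg ξ
    calc ‖symbol Λ ξ‖ ≤ A * anisoSize m (coords v ξ) := by rw [hsym]; exact hAb _
      _ = A / ε * (ε * anisoSize m (coords v ξ)) := by field_simp
      _ ≤ A / ε * (symbol Λ ξ).re := by gcongr; exact hre ξ
      _ ≤ A / ε * (1 + (symbol Λ ξ).re) := by gcongr; linarith
  norm_arg_le := by
    obtain ⟨B, hB, hBb⟩ := exists_norm_le_anisoSize hm v
    refine ⟨B * (1 + ε⁻¹), fun ξ => (hBb ξ).trans ?_⟩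
    have h0 := hΛ.re_symbol_nonneg ξ
    have h1 : anisoSize m (coords v ξ) ≤ ε⁻¹ * (symbol Λ ξ).re := by
      rw [inv_mul_eq_div, le_div_iff₀ hε, mul_comm]
      exact hre ξ
    have h2 : 0 ≤ ε⁻¹ := by positivity
    rw [mul_assoc]
    gcongr
    nlinarith

/-- The Legendre-Fenchel transform is finite because `R` grows at least quadratically in every
coordinate direction. -/
theorem bddAbove_legendreFenchel (hm : ∀ k, 0 < m k) (v : Module.Basis (Fin d) ℝ V) {ε : ℝ}
    (hε : 0 < ε) {R : (V →L[ℝ] ℝ) → ℝ} (hR : ∀ ξ, ε * anisoSize m (coords v ξ) ≤ R ξ) (x : V) :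
    BddAbove (Set.range fun ξ : V →L[ℝ] ℝ => ξ x - R ξ) := by
  refine ⟨∑ k, ((v.repr x k) ^ 2 / (4 * ε) + ε), ?_⟩
  rintro _ ⟨ξ, rfl⟩
  have h1 : ξ x = ∑ k, v.repr x k * ξ (v k) := by
    calc ξ x = ξ (∑ k, v.repr x k • v k) := by rw [v.sum_repr]
      _ = _ := by simp only [map_sum, map_smul, smul_eq_mul]
  have h2 : ξ x ≤ ∑ k, ((v.repr x k) ^ 2 / (4 * ε) + ε) + ε * anisoSize m (coords v ξ) := by
    rw [h1, anisoSize, Finset.mul_sum, ← Finset.sum_add_distrib]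
    refine Finset.sum_le_sum fun k _ => ?_
    simp only [coords, Complex.norm_real, Real.norm_eq_abs]
    set b := v.repr x k
    set y := ξ (v k)
    have h3 : b * y ≤ b ^ 2 / (4 * ε) + ε * |y| ^ 2 := by
      have : 0 ≤ (b - 2 * ε * y) ^ 2 / (4 * ε) := by positivity
      have h4 : (b - 2 * ε * y) ^ 2 / (4 * ε) = b ^ 2 / (4 * ε) - b * y + ε * y ^ 2 := by
        field_simp
        ring
      rw [sq_abs]
      linarith
    have h4 : |y| ^ 2 ≤ 1 + |y| ^ (2 * m k) := by
      rcases le_total |y| 1 with hy | hy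
      · have h5 : |y| ^ 2 ≤ 1 := pow_le_one₀ (abs_nonneg y) hy
        have h6 : 0 ≤ |y| ^ (2 * m k) := by positivity
        linarith
      · have := pow_le_pow_right₀ hy (show 2 ≤ 2 * m k by have := hm k; omega)
        linarith
    have := mul_le_mul_of_nonneg_left h4 hε.le
    linarith
  have := hR ξ
  simp only
  linarith

/-- A bound by `K e^{-c u_i}` for every `i` passes to the supremum. No boundedness of `u` is needed:
if `L > 0` the hypothesis bounds `u`, and otherwise the claim is trivial. -/
theorem le_mul_exp_neg_iSup {ι : Type*} [Nonempty ι] {u : ι → ℝ} {L K c : ℝ} (hK : 0 ≤ K)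
    (hc : 0 < c) (h : ∀ i, L ≤ K * Real.exp (-(c * u i))) :
    L ≤ K * Real.exp (-(c * ⨆ i, u i)) := by
  rcases le_or_gt L 0 with hL | hL
  · exact hL.trans (by positivity)
  · have hK0 : 0 < K := hK.lt_of_ne fun h0 => by
      have := h (Classical.arbitrary ι)
      rw [← h0, zero_mul] at this
      linarith
    have h1 : ⨆ i, u i ≤ Real.log (K / L) / c := by
      refine ciSup_le fun i => ?_
      rw [le_div_iff₀ hc, Real.le_log_iff_exp_le (by positivity), le_div_iff₀ hL]
      have h2 := h i
      rw [Real.exp_neg, ← div_eq_mul_inv, le_div_iff₀ (Real.exp_pos _)] at h2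
      rw [mul_comm (u i) c]
      linarith
    have h3 : c * ⨆ i, u i ≤ Real.log (K / L) := by
      rw [le_div_iff₀ hc] at h1
      linarith
    calc L = K * Real.exp (-Real.log (K / L)) := by
          rw [Real.exp_neg, Real.exp_log (by positivity)]
          field_simp
      _ ≤ _ := by gcongr

theorem anisoSize_smul_le (hm : ∀ k, 0 < m k) {s : ℝ} (hs0 : 0 ≤ s) (hs1 : s ≤ 1)
    (z : Fin d → ℂ) : anisoSize m ((s : ℂ) • z) ≤ s ^ 2 * anisoSize m z := by
  rw [anisoSize, anisoSize, Finset.mul_sum]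
  refine Finset.sum_le_sum fun k _ => ?_
  rw [Pi.smul_apply, norm_smul, mul_pow, Complex.norm_real, Real.norm_of_nonneg hs0]
  gcongr ?_ * _
  exact pow_le_pow_of_le_one hs0 hs1 (by have := hm k; omega)

/-- The total mass of `e^{-δt|ξ|}`, with `|·|` the anisotropic size, is at most of the order of
`t^{-μ_Λ}`. Comparing with `e^{-δ'tR}` lets any member of the exponent set be used, diagonalizable
or not. -/
theorem integral_exp_neg_anisoSize_le [FiniteDimensional ℝ V] {Λ : (V → ℂ) → (V → ℂ)} {muΛ : ℝ}
    (hmu : IsHomogeneousOrder Λ muΛ) {ν : Measure (V →L[ℝ] ℝ)} [ν.IsAddHaarMeasure]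
    (hP : IsHeatSymbol ν (symbol Λ)) (hm : ∀ k, 0 < m k) (v : Module.Basis (Fin d) ℝ V) {A δ : ℝ}
    (hA : 0 < A) (hδ : 0 < δ) (hAb : ∀ ξ, ‖symbol Λ ξ‖ ≤ A * anisoSize m (coords v ξ)) {t : ℝ}
    (ht : 0 < t) :
    ∫ ξ, Real.exp (-(t * δ * anisoSize m (coords v ξ))) ∂ν ≤
      t ^ (-muΛ) * ∫ ξ, Real.exp (-(δ / A * (symbol Λ ξ).re)) ∂ν := by
  obtain ⟨E, hE, rfl⟩ := hmu
  rw [← integral_exp_neg_mul_of_homogeneous ν E (δ / A) ht (F := fun ξ => (symbol Λ ξ).re)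
    fun ξ => by rw [symbol_comp_tpow hE ht, Complex.re_ofReal_mul]]
  refine integral_mono (integrable_exp_neg_anisoSize ν hm v (by positivity)) ?_ fun ξ => ?_
  · simp only [← mul_assoc]
    exact hP.integrable_exp _ (by positivity)
  · rw [Real.exp_le_exp, neg_le_neg_iff]
    have h1 := (Complex.re_le_norm _).trans (hAb ξ)
    calc δ / A * (t * (symbol Λ ξ).re) ≤ δ / A * (t * (A * anisoSize m (coords v ξ))) := by gcongr
      _ = _ := by field_simp

theorem heatKernel_eq_heatInt (ν : Measure (V →L[ℝ] ℝ)) (Λ : (V → ℂ) → (V → ℂ)) (t : ℝ) (x : V) :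
    heatKernel ν Λ t x = heatInt ν (symbol Λ) (fun _ => 1) (t, x) := by
  simp only [heatKernel, heatInt, planeWave, one_mul]

/-- The constants attached to a representation of the operator. -/
theorem IsRepresentedBy.exists_symbol_bounds [FiniteDimensional ℝ V] {Λ : (V → ℂ) → (V → ℂ)}
    (hΛ : IsPositiveHomogeneous Λ) (ν : Measure (V →L[ℝ] ℝ)) [ν.IsAddHaarMeasure]
    {v : Module.Basis (Fin d) ℝ V} (hv : IsRepresentedBy Λ v m) :
    ∃ (a : (Fin d → ℕ) →₀ ℂ) (A ε C : ℝ), 0 < A ∧ 0 < ε ∧ 0 < C ∧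
      (∀ ξ, symbol Λ ξ = polyFun a (coords v ξ)) ∧
      (∀ z, ‖polyFun a z‖ ≤ A * anisoSize m z) ∧
      (∀ z, ε * anisoSize m z ≤ (polyFun a z).re + C * anisoSize m (imPart z)) ∧
      (∀ ξ, ε * anisoSize m (coords v ξ) ≤ (symbol Λ ξ).re) ∧
      IsHeatSymbol ν (symbol Λ) := by
  obtain ⟨hm, a, hwt, ha⟩ := hv
  have hsym := symbol_eq_polyFun ha
  obtain ⟨A, hA, hAb⟩ := exists_norm_polyFun_le hm hwt
  obtain ⟨ε, C, hε, hC, hre⟩ := exists_le_re_polyFun hm hwt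
    fun z hz hz0 => re_polyFun_pos hΛ ha hz hz0
  have hre' : ∀ ξ, ε * anisoSize m (coords v ξ) ≤ (symbol Λ ξ).re := by
    intro ξ
    have h1 := hre (coords v ξ)
    have h2 : anisoSize m (0 : Fin d → ℂ) = 0 :=
      Finset.sum_eq_zero fun k _ => by
        have := hm k
        simp only [Pi.zero_apply, norm_zero]
        exact zero_pow (by omega)
    rwa [imPart_coords, h2, mul_zero, add_zero, ← hsym] at h1
  exact ⟨a, A, ε, C, hA, hε, hC, hsym, hAb, hre, hre',
    isHeatSymbol_symbol hΛ ν hm hsym hA hε hAb hre'⟩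

theorem IsRepresentedBy.exists_heatKernel_bounds [FiniteDimensional ℝ V] {Λ : (V → ℂ) → (V → ℂ)}
    (hΛ : IsPositiveHomogeneous Λ) {muΛ : ℝ} (hmu : IsHomogeneousOrder Λ muΛ)
    (ν : Measure (V →L[ℝ] ℝ)) [ν.IsAddHaarMeasure] {R : (V →L[ℝ] ℝ) → ℝ}
    (hR : ∀ ξ, R ξ = (symbol Λ ξ).re) {v : Module.Basis (Fin d) ℝ V}
    (hv : IsRepresentedBy Λ v m) :
    ∃ (C₀ M : ℝ) (C : (Fin d → ℕ) → ℝ), 0 < C₀ ∧ 0 < M ∧ (∀ β, 0 < C β) ∧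
      (∀ (k : ℕ) (β : Fin d → ℕ) (t : ℝ), 0 < t → ∀ x : V,
        ‖iteratedDeriv k (fun s : ℝ => multiD v β (heatKernel ν Λ s) x) t‖ ≤
          C β * C₀ ^ k * (k.factorial : ℝ) / t ^ (muΛ + (k : ℝ) + wt β (fun j => 2 * m j)) *
            Real.exp (-(t * M * legendreFenchel R ((1 / t) • x)))) ∧
      (∀ t : ℝ, 0 < t → ∀ x : V, ‖heatKernel ν Λ t x‖ ≤
        C₀ / t ^ muΛ * Real.exp (-(t * M * legendreFenchel R ((1 / t) • x)))) := by
  have hm := hv.1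
  obtain ⟨a, A, ε, C, hA, hε, hC, hsym, hAb, hre, hre', hP⟩ := hv.exists_symbol_bounds hΛ ν
  set J := ∫ ξ, Real.exp (-(ε / 3 / A * (symbol Λ ξ).re)) ∂ν with hJ
  have hJ0 : 0 ≤ J := integral_nonneg fun ξ => (Real.exp_pos _).le
  -- With `M = 1 / (1 + C / ε)`, the contour shift `η = -Mξ` bounds the exponent
  -- `η(x) + tC|η|` by `-tM(ξ(x/t) - R(ξ))`.
  set M : ℝ := 1 / (1 + C / ε) with hM
  have hM0 : 0 < M := by positivity
  have hM1 : M ≤ 1 := by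
    rw [hM, div_le_one (by positivity)]
    have : 0 < C / ε := by positivity
    linarith
  have hMC : M * (C / ε) ≤ 1 := by
    rw [hM, one_div_mul_eq_div, div_le_one (by positivity)]
    linarith
  let W : (Fin d → ℕ) → ℝ := fun β => wt β (fun j => 2 * m j)
  let D : (Fin d → ℕ) → ℝ := fun β => (W β / (ε / 3)) ^ W β * J + 1
  have hW0 : ∀ β, 0 ≤ W β := fun β => wt_nonneg _ _
  have hD0 : ∀ β, 0 < D β := fun β => by
    have := hW0 β
    positivity
  have main : ∀ (k : ℕ) (β : Fin d → ℕ) (t : ℝ), 0 < t → ∀ x : V,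
      ‖iteratedDeriv k (fun s : ℝ => multiD v β (heatKernel ν Λ s) x) t‖ ≤
        D β * (A / (ε / 3)) ^ k * (k.factorial : ℝ) / t ^ (muΛ + (k : ℝ) + W β) *
          Real.exp (-(t * M * legendreFenchel R ((1 / t) • x))) := by
    intro k β t ht x
    refine le_mul_exp_neg_iSup (by have := hD0 β; positivity) (by positivity) fun ξ => ?_
    have hf : ∀ s, 0 < s → multiD v β (heatKernel ν Λ s) x =
        heatInt ν (symbol Λ) (fun ξ => ∏ j, coords v ξ j ^ β j) (s, x) := by
      intro s hs
      rw [show heatKernel ν Λ s = fun x => heatInt ν (symbol Λ) (fun _ => 1) (s, x) from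
        funext fun x => heatKernel_eq_heatInt ν Λ s x, hP.multiD_heatInt hs]
    rw [hP.iteratedDeriv_heatInt (hP.isAmplitude_prod_pow v β) hf k ht]
    have hci : heatInt ν (symbol Λ)
        (fun ξ => (-symbol Λ ξ) ^ k * ∏ j, coords v ξ j ^ β j) (t, x) =
        ∫ η, complexIntegrand v a β k t x (-(M • ξ)) η 0 ∂ν := by
      simp only [heatInt, complexIntegrand, zero_smul, zero_mul, add_zero, hsym, planeWave]
    rw [hci]
    refine (norm_integral_le_of_shift ν hm v hA hAb hε hC hre β k ht x (-(M • ξ))).trans ?_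
    have hint := integral_exp_neg_anisoSize_le hmu hP hm v hA (show 0 < ε / 3 by positivity)
      (fun ξ => by rw [hsym]; exact hAb _) ht
    have hexp : (-(M • ξ)) x + t * C * anisoSize m (coords v (-(M • ξ))) ≤
        -(t * M * (ξ ((1 / t) • x) - R ξ)) := by
      have h1 : anisoSize m (coords v (-(M • ξ))) ≤ M ^ 2 * anisoSize m (coords v ξ) := by
        refine le_trans (le_of_eq ?_) (anisoSize_smul_le hm hM0.le hM1 (coords v ξ))
        simp [anisoSize, coords]
      have h2 : C * anisoSize m (coords v ξ) ≤ C / ε * R ξ := by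
        calc C * anisoSize m (coords v ξ) = C / ε * (ε * anisoSize m (coords v ξ)) := by field_simp
          _ ≤ C / ε * R ξ := by rw [hR]; gcongr; exact hre' ξ
      have hRξ : 0 ≤ R ξ := by rw [hR]; exact hΛ.re_symbol_nonneg ξ
      have h3 : t * C * anisoSize m (coords v (-(M • ξ))) ≤ t * M * R ξ := by
        calc t * C * anisoSize m (coords v (-(M • ξ)))
            ≤ t * C * (M ^ 2 * anisoSize m (coords v ξ)) := by gcongr
          _ = t * M ^ 2 * (C * anisoSize m (coords v ξ)) := by ring
          _ ≤ t * M ^ 2 * (C / ε * R ξ) := by gcongr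
          _ = t * M * ((M * (C / ε)) * R ξ) := by ring
          _ ≤ t * M * (1 * R ξ) := by gcongr
          _ = t * M * R ξ := by rw [one_mul]
      have h4 : (-(M • ξ)) x = -(M * ξ x) := by simp
      have h5 : t * M * (ξ ((1 / t) • x) - R ξ) = M * ξ x - t * M * R ξ := by
        rw [map_smul, smul_eq_mul]
        field_simp
      rw [h4, h5]
      linarith
    have hWβ := hW0 β
    have hJ1 : (W β / (ε / 3)) ^ W β * J ≤ D β := by simp only [D]; linarith
    calc _ ≤ (W β / (ε / 3)) ^ W β * (A / (ε / 3)) ^ k * k.factorial / t ^ (k + W β) *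
            Real.exp (-(t * M * (ξ ((1 / t) • x) - R ξ))) * (t ^ (-muΛ) * J) := by
          gcongr
      _ = ((W β / (ε / 3)) ^ W β * J) * (A / (ε / 3)) ^ k * k.factorial /
            t ^ (muΛ + (k : ℝ) + W β) * Real.exp (-(t * M * (ξ ((1 / t) • x) - R ξ))) := by
          rw [add_assoc muΛ, Real.rpow_add ht muΛ, Real.rpow_neg ht.le]
          field_simp
      _ ≤ _ := by gcongr
  refine ⟨A / (ε / 3) + D 0, M, D, by have := hD0 0; positivity, hM0, hD0, ?_, ?_⟩
  · intro k β t ht x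
    refine (main k β t ht x).trans ?_
    have := hD0 β
    have := hD0 0
    gcongr
    linarith
  · intro t ht x
    have h0 : multiD v 0 (heatKernel ν Λ t) = heatKernel ν Λ t := by
      funext x
      rw [show heatKernel ν Λ t = fun x => heatInt ν (symbol Λ) (fun _ => 1) (t, x) from
        funext fun x => heatKernel_eq_heatInt ν Λ t x, hP.multiD_heatInt ht]
      simp
    have h1 := main 0 0 t ht x
    have hW : W 0 = 0 := by simp [W, wt]
    rw [iteratedDeriv_zero, h0, hW] at h1
    simp only [pow_zero, mul_one, Nat.factorial_zero, Nat.cast_one, Nat.cast_zero,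
      add_zero] at h1
    refine h1.trans ?_
    have := hD0 0
    gcongr
    have : 0 < A / (ε / 3) := by positivity
    linarith

end Estimates

end PosHom

end

theorem mainTheorem2 {V : Type*} [NormedAddCommGroup V] [NormedSpace ℝ V]
    [FiniteDimensional ℝ V] [MeasurableSpace V] [BorelSpace V]
    (d : ℕ) (hd : Module.finrank ℝ V = d)
    (μ : Measure V) [μ.IsAddHaarMeasure]
    (ν : Measure (V →L[ℝ] ℝ)) [ν.IsAddHaarMeasure] (hν : PosHom.IsDualHaar μ ν)
    (Λ : (V → ℂ) → (V → ℂ)) (hΛ : PosHom.IsPositiveHomogeneous Λ)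
    (muΛ : ℝ) (hmu : PosHom.IsHomogeneousOrder Λ muΛ)
    (R : (V →L[ℝ] ℝ) → ℝ) (hR : ∀ ξ, R ξ = (PosHom.symbol Λ ξ).re) :
    -- the integral defining the heat kernel converges, the kernel is smooth, and the supremum
    -- defining the Legendre-Fenchel transform is finite
    (∀ t : ℝ, 0 < t → Integrable
      (fun ξ : V →L[ℝ] ℝ => Complex.exp (-((t : ℂ) * PosHom.symbol Λ ξ))) ν) ∧
    ContDiffOn ℝ ∞ (fun p : ℝ × V => PosHom.heatKernel ν Λ p.1 p.2)
      (Set.Ioi (0 : ℝ) ×ˢ (Set.univ : Set V)) ∧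
    (∀ x : V, BddAbove (Set.range fun ξ : V →L[ℝ] ℝ => ξ x - R ξ)) ∧
    -- a basis and weights representing the operator exist
    (∃ (v : Module.Basis (Fin d) ℝ V) (m : Fin d → ℕ), PosHom.IsRepresentedBy Λ v m) ∧
    -- the estimates hold for all such bases and weights
    ∀ (v : Module.Basis (Fin d) ℝ V) (m : Fin d → ℕ), PosHom.IsRepresentedBy Λ v m →
      ∃ (C₀ M : ℝ) (C : (Fin d → ℕ) → ℝ), 0 < C₀ ∧ 0 < M ∧ (∀ β, 0 < C β) ∧
        (∀ (k : ℕ) (β : Fin d → ℕ) (t : ℝ), 0 < t → ∀ x y : V,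
          ‖iteratedDeriv k
              (fun s : ℝ => PosHom.multiD v β (PosHom.heatKernel ν Λ s) (x - y)) t‖ ≤
            C β * C₀ ^ k * (k.factorial : ℝ) /
                t ^ (muΛ + (k : ℝ) + PosHom.wt β (fun j => 2 * m j)) *
              Real.exp (-(t * M * PosHom.legendreFenchel R ((1 / t) • (x - y))))) ∧
        (∀ t : ℝ, 0 < t → ∀ x y : V,
          ‖PosHom.heatKernel ν Λ t (x - y)‖ ≤
            C₀ / t ^ muΛ *
              Real.exp (-(t * M * PosHom.legendreFenchel R ((1 / t) • (x - y))))) := by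
  obtain ⟨v₀, m₀, hrep⟩ := hΛ.exists_isRepresentedBy hd
  obtain ⟨-, -, ε₀, -, -, hε₀, -, -, -, -, hre₀, hP⟩ := hrep.exists_symbol_bounds hΛ ν
  refine ⟨fun t ht => ?_, ?_, fun x => ?_, ⟨v₀, m₀, hrep⟩, fun v m hvm => ?_⟩
  · simpa [PosHom.planeWave] using hP.integrable (hP.isAmplitude_const 1) ht 0
  · simp only [PosHom.heatKernel_eq_heatInt]
    exact hP.contDiffOn_heatInt (hP.isAmplitude_const 1)
  · exact PosHom.bddAbove_legendreFenchel hrep.1 v₀ hε₀ (fun ξ => by rw [hR]; exact hre₀ ξ) x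
  · obtain ⟨C₀, M, C, hC₀, hM, hC, h, h'⟩ := hvm.exists_heatKernel_bounds hΛ hmu ν hR
    exact ⟨C₀, M, C, hC₀, hM, hC, fun k β t ht x y => h k β t ht (x - y),
      fun t ht x y => h' t ht (x - y)⟩
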